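/- Let \(d\in\mathbb N\) and let \(\Omega\subset\mathbb R^d\) be a bounded open set satisfying an interior cone condition, that is, there are \(\theta\in(0,\pi/2)\) and \(r>0\) such that for every \(x\in\Omega\) there is a unit vector \(\xi\) with \(\{x+ty : \|y\|_2=1,\ y\cdot\xi\ge\cos\theta,\ t\in[0,r]\}\subset\Omega\) (for example, any bounded Lipschitz domain). For real \(p\ge 0\), write \(g\in C^p(\Omega)\) if all partial derivatives \(D^q g\) with \(|q|\le\lfloor p\rfloor\) exist on \(\Omega\) and are continuous, bounded and \((p-\lfloor p\rfloor)\)-Hölder continuous on \(\Omega\). Write \(k\in C^{p,p}(\Omega\times\Omega)\) if all mixed partial derivatives \(D^{q,q'}k\) (of order \(q\) in the first and \(q'\) in the second argument) with \(|q|\le\lfloor p\rfloor\) and \(|q'|\le\lfloor p\rfloor\) exist on \(\Omega\times\Omega\) and are continuous, bounded and \((p-\lfloor p\rfloor)\)-Hölder continuous on \(\Omega\times\Omega\). (\(0\)-Hölder continuity is no condition beyond boundedness.) **Lemma.** Let \(p>0\) be real, let \(k\in C^{p,p}(\Omega\times\Omega)\), and let \(g\sim\mathrm{GP}(0,k)\)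 be a Gaussian process \((g(u))_{u\in\Omega}\), on any probability space, with mean zero and covariance function \(k\). Then there is a modification \(\tilde g\) of \(g\), i.e. a family of random variables \((\tilde g(u))_{u\in\Omega}\) on the same probability space with \(\mathbb P[g(u)=\tilde g(u)]=1\) for each \(u\in\Omega\), such that \(\tilde g\in C^{\lceil p-1\rceil}(\Omega)\) almost surely. -/

import Mathlib

open MeasureTheory ProbabilityTheory Set
open scoped NNReal

noncomputable section

/-- The interior cone condition: for some angle `θ ∈ (0, π/2)` and radius `r > 0`, every point `x`
of `Ω` is the apex of a cone `{x + t y : ‖y‖ = 1, ⟪y, ξ⟫ ≥ cos θ, t ∈ [0, r]}` inside `Ω`. -/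
def InteriorConeCondition {d : ℕ} (Ω : Set (EuclideanSpace ℝ (Fin d))) : Prop :=
  ∃ θ ∈ Ioo (0 : ℝ) (Real.pi / 2), ∃ r > (0 : ℝ), ∀ x ∈ Ω,
    ∃ ξ : EuclideanSpace ℝ (Fin d), ‖ξ‖ = 1 ∧
    ∀ y : EuclideanSpace ℝ (Fin d), ‖y‖ = 1 → Real.cos θ ≤ inner ℝ y ξ →
      ∀ t ∈ Icc (0 : ℝ) r, x + t • y ∈ Ω

/-- The iterated partial derivative `∂_{a₁} ∂_{a₂} ⋯ ∂_{aₙ} f` for a list `[a₁, …, aₙ]` of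
coordinates. A list of length `n` encodes a multi-index `q` with `|q| = n`, together with an order
in which the derivatives are taken. -/
def iterPartial {d : ℕ} :
    List (Fin d) → (EuclideanSpace ℝ (Fin d) → ℝ) → EuclideanSpace ℝ (Fin d) → ℝ
  | [], f => f
  | a :: l, f => fun u => lineDeriv ℝ (iterPartial l f) u (EuclideanSpace.single a 1)

/-- The iterated partial derivative `iterPartial l f` exists at every point of the open set `Ω`. -/
def HasIterPartial {d : ℕ} (Ω : Set (EuclideanSpace ℝ (Fin d))) :
    List (Fin d) → (EuclideanSpace ℝ (Fin d) → ℝ) → Prop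
  | [], _ => True
  | a :: l, f => HasIterPartial Ω l f ∧
      ∀ u ∈ Ω, LineDifferentiableAt ℝ (iterPartial l f) u (EuclideanSpace.single a 1)

/-- `f` is continuous, bounded and `γ`-Hölder continuous on `s`. For `γ = 0` the Hölder bound
follows from boundedness, so that this means "continuous and bounded". -/
def IsHolderOn {α : Type*} [PseudoMetricSpace α] (s : Set α) (γ : ℝ≥0) (f : α → ℝ) : Prop :=
  ContinuousOn f s ∧ (∃ M : ℝ, ∀ x ∈ s, |f x| ≤ M) ∧ ∃ C : ℝ≥0, HolderOnWith C γ f s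

/-- `g ∈ C^p(Ω)`, `Ω` open, `p ≥ 0` real: all partial derivatives of `g` of order at most `⌊p⌋`
exist on `Ω` and are continuous, bounded and `(p - ⌊p⌋)`-Hölder continuous there. -/
def MemC {d : ℕ} (Ω : Set (EuclideanSpace ℝ (Fin d))) (p : ℝ)
    (g : EuclideanSpace ℝ (Fin d) → ℝ) : Prop :=
  ∀ l : List (Fin d), l.length ≤ ⌊p⌋₊ →
    HasIterPartial Ω l g ∧ IsHolderOn Ω (p - ⌊p⌋₊).toNNReal (iterPartial l g)

/-- The mixed partial derivative `D^{l, l'} k`: first the derivatives `l'` in the second argument,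
then the derivatives `l` in the first one. -/
def mixedPartial {d : ℕ} (l l' : List (Fin d))
    (k : EuclideanSpace ℝ (Fin d) → EuclideanSpace ℝ (Fin d) → ℝ)
    (u v : EuclideanSpace ℝ (Fin d)) : ℝ :=
  iterPartial l (fun w => iterPartial l' (k w) v) u

/-- `k ∈ C^{p,p}(Ω × Ω)`, `Ω` open, `p ≥ 0` real: all mixed partial derivatives of `k` of order at
most `⌊p⌋` in each of the two arguments exist on `Ω × Ω` and are continuous, bounded and
`(p - ⌊p⌋)`-Hölder continuous there. -/
def MemCC {d : ℕ} (Ω : Set (EuclideanSpace ℝ (Fin d))) (p : ℝ)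
    (k : EuclideanSpace ℝ (Fin d) → EuclideanSpace ℝ (Fin d) → ℝ) : Prop :=
  ∀ l l' : List (Fin d), l.length ≤ ⌊p⌋₊ → l'.length ≤ ⌊p⌋₊ →
    (∀ u ∈ Ω, HasIterPartial Ω l' (k u)) ∧
    (∀ v ∈ Ω, HasIterPartial Ω l (fun w => iterPartial l' (k w) v)) ∧
    IsHolderOn (Ω ×ˢ Ω) (p - ⌊p⌋₊).toNNReal (fun z => mixedPartial l l' k z.1 z.2)

/-- `g ∼ GP(0, k)` on `Ω`: the family `(g u)_{u ∈ Ω}` is a Gaussian process with mean zero and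
covariance function `k`. Only the values at `u, v ∈ Ω` matter. (This forces `k` to be a positive
semi-definite kernel on `Ω`.) -/
structure IsCenteredGP {d : ℕ} {S : Type*} [MeasurableSpace S] (P : Measure S)
    (Ω : Set (EuclideanSpace ℝ (Fin d)))
    (k : EuclideanSpace ℝ (Fin d) → EuclideanSpace ℝ (Fin d) → ℝ)
    (g : EuclideanSpace ℝ (Fin d) → S → ℝ) : Prop where
  isGaussianProcess : IsGaussianProcess (fun u : Ω => g u) P
  mean_eq_zero : ∀ u ∈ Ω, ∫ ω, g u ω ∂P = 0
  covariance_eq : ∀ u ∈ Ω, ∀ v ∈ Ω, covariance (g u) (g v) P = k u v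

/-- `g'` is a modification on `Ω` of the process `g`: each `g' u` is a random variable that equals
`g u` almost surely. -/
def IsModification {d : ℕ} {S : Type*} [MeasurableSpace S] (P : Measure S)
    (Ω : Set (EuclideanSpace ℝ (Fin d))) (g g' : EuclideanSpace ℝ (Fin d) → S → ℝ) : Prop :=
  ∀ u ∈ Ω, Measurable (g' u) ∧ ∀ᵐ ω ∂P, g u ω = g' u ω

end

open Filter Topology
open scoped ENNReal

/-! ### Directional derivatives and second-order differences -/

section LineDerivatives

variable {E F : Type*} [NormedAddCommGroup E] [NormedSpace ℝ E]
  [NormedAddCommGroup F] [NormedSpace ℝ F]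

/-! Read the process as a map `G : Ω → L²(P)` with `⟪G u, G v⟫ = k u v`. Inner products of
difference quotients of `G` are second-order difference quotients of `k`. Hence smoothness of `k` in
both arguments makes `G` differentiable in quadratic mean up to order `⌊p⌋`, with `⟪D^l G u, D^l G
v⟫ = D^{l,l} k u v` (`MemCC.inner_vecIterPartial`).

For `|l| < p` the map `D^l G` is Hölder in L², at least on convex subsets of `Ω` and on finitely
many pieces covering `Ω` (`MemCC.isPiecewiseHolder`). All these derivatives stay in the closed
linear span of the process, where the L² norm controls every moment
(`IsGaussianProcess.lintegral_enorm_pow_le`). Any positive Hölder exponent is therefore enough for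
Kolmogorov's criterion (`ae_uniformContinuousOn_of_moment`): almost surely, `D^l G` restricted to
the rational points of `Ω` is bounded and extends continuously to `Ω` (`ae_tendsto_and_bounded`).

It remains to see that these extensions are derivatives of one another. Riemann sums in L² give a
mean value inequality between `D^l G` and its partial derivatives, almost surely for all rational
points and steps at once (`ae_rational_increments`). By density it passes to the continuous
extensions and forces differentiability (`hasLineDerivAt_of_rational_increments`). Since `⌈p - 1⌉`
is the largest integer below `p`, every required order is covered. -/

theorem HasLineDerivAt.hasDerivAt_line {f : E → F} {f' : F} {x e : E} {s : ℝ}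
    (h : HasLineDerivAt ℝ f f' (x + s • e) e) : HasDerivAt (fun t : ℝ => f (x + t • e)) f' s := by
  have h1 : HasDerivAt (fun t : ℝ => f (x + s • e + t • e)) f' (s - s) := by
    rw [sub_self]; exact h
  have h2 := h1.comp_sub_const s s
  refine h2.congr_of_eventuallyEq (Eventually.of_forall fun t => ?_)
  simp only [add_assoc, ← add_smul, add_sub_cancel]

theorem exists_line_slope {f f' : E → ℝ} {x e : E} {s : ℝ}
    (h : ∀ t : ℝ, |t| ≤ |s| → HasLineDerivAt ℝ f (f' (x + t • e)) (x + t • e) e) :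
    ∃ ξ : ℝ, |ξ| ≤ |s| ∧ f (x + s • e) - f x = s * f' (x + ξ • e) := by
  have hd : ∀ t : ℝ, |t| ≤ |s| → HasDerivAt (fun t : ℝ => f (x + t • e)) (f' (x + t • e)) t :=
    fun t ht => (h t ht).hasDerivAt_line
  rcases lt_trichotomy s 0 with hs | rfl | hs
  · have hle : ∀ t ∈ Icc s 0, |t| ≤ |s| := fun t ht => by
      rw [abs_of_nonpos ht.2, abs_of_neg hs]; linarith [ht.1]
    obtain ⟨ξ, hξ, hh⟩ := exists_hasDerivAt_eq_slope (fun t : ℝ => f (x + t • e))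
      (fun t => f' (x + t • e)) hs
      (fun t ht => (hd t (hle t ht)).continuousAt.continuousWithinAt)
      (fun t ht => hd t (hle t (Ioo_subset_Icc_self ht)))
    refine ⟨ξ, hle ξ (Ioo_subset_Icc_self hξ), ?_⟩
    rw [hh]
    have : (0 : ℝ) - s ≠ 0 := by linarith
    field_simp
    simp only [zero_smul, add_zero, zero_sub]
    ring
  · exact ⟨0, le_rfl, by simp⟩
  · have hle : ∀ t ∈ Icc 0 s, |t| ≤ |s| := fun t ht => by
      rw [abs_of_nonneg ht.1, abs_of_pos hs]; exact ht.2
    obtain ⟨ξ, hξ, hh⟩ := exists_hasDerivAt_eq_slope (fun t : ℝ => f (x + t • e))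
      (fun t => f' (x + t • e)) hs
      (fun t ht => (hd t (hle t ht)).continuousAt.continuousWithinAt)
      (fun t ht => hd t (hle t (Ioo_subset_Icc_self ht)))
    refine ⟨ξ, hle ξ (Ioo_subset_Icc_self hξ), ?_⟩
    rw [hh]
    have : s - (0 : ℝ) ≠ 0 := by linarith
    field_simp
    simp only [zero_smul, add_zero, sub_zero]
    ring

/-- The second-order difference of a function of two variables equals a value of the mixed
derivative. -/
theorem exists_double_difference {f f₂ f₁₂ : E → E → ℝ} {u v e e' : E} {s t : ℝ}
    (h₂ : ∀ ξ η : ℝ, |ξ| ≤ |s| → |η| ≤ |t| →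
      HasLineDerivAt ℝ (f (u + ξ • e)) (f₂ (u + ξ • e) (v + η • e')) (v + η • e') e')
    (h₁₂ : ∀ ξ η : ℝ, |ξ| ≤ |s| → |η| ≤ |t| →
      HasLineDerivAt ℝ (fun w => f₂ w (v + η • e')) (f₁₂ (u + ξ • e) (v + η • e'))
        (u + ξ • e) e) :
    ∃ ξ η : ℝ, |ξ| ≤ |s| ∧ |η| ≤ |t| ∧
      f (u + s • e) (v + t • e') - f u (v + t • e') - (f (u + s • e) v - f u v) =
        s * t * f₁₂ (u + ξ • e) (v + η • e') := by
  -- Mean value theorem in the second variable for the difference of two sections of `f`, then in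
  -- the first variable for `f₂` at the intermediate point.
  obtain ⟨η, hη, h⟩ := exists_line_slope (f := fun y => f (u + s • e) y - f u y)
    (f' := fun y => f₂ (u + s • e) y - f₂ u y) (x := v) (e := e') (s := t) (fun η hη => by
      have h1 := h₂ s η le_rfl hη
      have h2 := h₂ 0 η (by simp) hη
      simp only [zero_smul, add_zero] at h2
      exact HasDerivAt.sub h1 h2)
  obtain ⟨ξ, hξ, h'⟩ := exists_line_slope (f := fun w => f₂ w (v + η • e'))
    (f' := fun w => f₁₂ w (v + η • e')) (x := u) (e := e) (s := s) (fun ξ hξ => h₁₂ ξ η hξ hη)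
  refine ⟨ξ, η, hξ, hη, ?_⟩
  rw [h, h']
  ring

theorem eventually_line_mem {U : Set E} (hU : IsOpen U) {u : E} (hu : u ∈ U) (e : E) :
    ∀ᶠ s : ℝ in 𝓝 0, ∀ ξ : ℝ, |ξ| ≤ |s| → u + ξ • e ∈ U := by
  have hc : Tendsto (fun s : ℝ => u + s • e) (𝓝 0) (𝓝 u) := by
    have : Continuous fun s : ℝ => u + s • e := by fun_prop
    simpa using this.tendsto 0
  obtain ⟨r, hr, h⟩ := Metric.eventually_nhds_iff.1 (hc.eventually (hU.mem_nhds hu))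
  refine Metric.eventually_nhds_iff.2 ⟨r, hr, fun s hs ξ hξ => h ?_⟩
  rw [Real.dist_0_eq_abs] at hs ⊢
  exact hξ.trans_lt hs

/-- The second-order difference quotients converge to the mixed derivative. -/
theorem tendsto_double_difference {Ω : Set E} (hΩ : IsOpen Ω) {f f₂ f₁₂ : E → E → ℝ} {e e' : E}
    (h₂ : ∀ u ∈ Ω, ∀ v ∈ Ω, HasLineDerivAt ℝ (f u) (f₂ u v) v e')
    (h₁₂ : ∀ u ∈ Ω, ∀ v ∈ Ω, HasLineDerivAt ℝ (fun w => f₂ w v) (f₁₂ u v) u e)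
    (hc : ContinuousOn (fun z : E × E => f₁₂ z.1 z.2) (Ω ×ˢ Ω)) {u v : E} (hu : u ∈ Ω)
    (hv : v ∈ Ω) {ε : ℝ} (hε : 0 < ε) :
    ∃ δ > 0, ∀ s t : ℝ, s ≠ 0 → t ≠ 0 → |s| < δ → |t| < δ →
      |s⁻¹ * t⁻¹ * (f (u + s • e) (v + t • e') - f u (v + t • e') -
        (f (u + s • e) v - f u v)) - f₁₂ u v| < ε := by
  have hcont : ContinuousAt (fun z : E × E => f₁₂ z.1 z.2) (u, v) :=
    hc.continuousAt ((hΩ.prod hΩ).mem_nhds ⟨hu, hv⟩)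
  have hline : Tendsto (fun z : ℝ × ℝ => (u + z.1 • e, v + z.2 • e')) (𝓝 (0, 0)) (𝓝 (u, v)) := by
    have : Continuous fun z : ℝ × ℝ => (u + z.1 • e, v + z.2 • e') := by fun_prop
    simpa using this.tendsto (0, 0)
  have hlim := hcont.tendsto.comp hline
  obtain ⟨δ₁, hδ₁, h1⟩ := Metric.tendsto_nhds_nhds.1 hlim ε hε
  obtain ⟨δ₂, hδ₂, h2⟩ := Metric.eventually_nhds_iff.1 (eventually_line_mem hΩ hu e)
  obtain ⟨δ₃, hδ₃, h3⟩ := Metric.eventually_nhds_iff.1 (eventually_line_mem hΩ hv e')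
  refine ⟨min δ₁ (min δ₂ δ₃), by positivity, fun s t hs0 ht0 hs ht => ?_⟩
  have hs2 : dist s 0 < δ₂ := by
    rw [Real.dist_0_eq_abs]; exact hs.trans_le ((min_le_right _ _).trans (min_le_left _ _))
  have ht3 : dist t 0 < δ₃ := by
    rw [Real.dist_0_eq_abs]; exact ht.trans_le ((min_le_right _ _).trans (min_le_right _ _))
  obtain ⟨ξ, η, hξ, hη, h⟩ := exists_double_difference (f := f) (f₂ := f₂) (f₁₂ := f₁₂)
    (u := u) (v := v) (e := e) (e' := e') (s := s) (t := t)
    (fun ξ η hξ hη => h₂ _ (h2 hs2 ξ hξ) _ (h3 ht3 η hη))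
    (fun ξ η hξ hη => h₁₂ _ (h2 hs2 ξ hξ) _ (h3 ht3 η hη))
  have h4 := @h1 (ξ, η) (by
    rw [Prod.dist_eq, Real.dist_0_eq_abs, Real.dist_0_eq_abs]
    exact max_lt (hξ.trans_lt (hs.trans_le (min_le_left _ _)))
      (hη.trans_lt (ht.trans_le (min_le_left _ _))))
  simp only [Function.comp, Real.dist_eq] at h4
  rw [h]
  convert h4 using 2
  field_simp

/-- Interchange of the order of differentiation: if `∂₁ ∂₂ f` exists and is continuous and
`∂₁ f` exists, then `∂₂ ∂₁ f` exists and equals `∂₁ ∂₂ f`. -/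
theorem hasLineDerivAt_swap {Ω : Set E} (hΩ : IsOpen Ω) {f f₁ f₂ f₁₂ : E → E → ℝ} {e e' : E}
    (h₁ : ∀ u ∈ Ω, ∀ v ∈ Ω, HasLineDerivAt ℝ (fun w => f w v) (f₁ u v) u e)
    (h₂ : ∀ u ∈ Ω, ∀ v ∈ Ω, HasLineDerivAt ℝ (f u) (f₂ u v) v e')
    (h₁₂ : ∀ u ∈ Ω, ∀ v ∈ Ω, HasLineDerivAt ℝ (fun w => f₂ w v) (f₁₂ u v) u e)
    (hc : ContinuousOn (fun z : E × E => f₁₂ z.1 z.2) (Ω ×ˢ Ω)) {u v : E} (hu : u ∈ Ω)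
    (hv : v ∈ Ω) : HasLineDerivAt ℝ (f₁ u) (f₁₂ u v) v e' := by
  have key : Tendsto (fun t : ℝ => t⁻¹ • (f₁ u (v + t • e') - f₁ u v)) (𝓝[≠] 0)
      (𝓝 (f₁₂ u v)) := by
    rw [Metric.tendsto_nhds]
    intro ε hε
    obtain ⟨δ, hδ, h⟩ := tendsto_double_difference hΩ h₂ h₁₂ hc hu hv (half_pos hε)
    have hball : ∀ᶠ t : ℝ in 𝓝[≠] 0, |t| < δ := by
      refine nhdsWithin_le_nhds (Metric.eventually_nhds_iff.2 ⟨δ, hδ, fun t ht => ?_⟩)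
      rwa [Real.dist_0_eq_abs] at ht
    filter_upwards [hball, self_mem_nhdsWithin,
      nhdsWithin_le_nhds (eventually_line_mem hΩ hv e')] with t ht ht0 hmem
    -- For fixed `t`, letting `s → 0` turns the double quotient into the quotient of `f₁`; the bound
    -- `ε / 2`, uniform in `s`, survives as a weak inequality.
    have l1 := (h₁ u hu _ (hmem t le_rfl)).tendsto_slope_zero
    have l2 := (h₁ u hu v hv).tendsto_slope_zero
    have l3 : Tendsto (fun s : ℝ => |s⁻¹ * t⁻¹ * (f (u + s • e) (v + t • e') - f u (v + t • e') -
        (f (u + s • e) v - f u v)) - f₁₂ u v|) (𝓝[≠] 0)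
        (𝓝 |t⁻¹ • (f₁ u (v + t • e') - f₁ u v) - f₁₂ u v|) := by
      refine Tendsto.abs (Tendsto.sub_const ?_ _)
      refine ((l1.sub l2).const_smul t⁻¹).congr fun s => ?_
      simp only [smul_eq_mul]
      ring
    rw [Real.dist_eq]
    refine lt_of_le_of_lt (le_of_tendsto l3 ?_) (half_lt_self hε)
    filter_upwards [hball, self_mem_nhdsWithin] with s hs hs0
    exact (h s t hs0 ht0 hs ht).le
  have : HasDerivAt (fun t : ℝ => f₁ u (v + t • e')) (f₁₂ u v) 0 := by
    rw [hasDerivAt_iff_tendsto_slope_zero]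
    simpa using key
  exact this

end LineDerivatives

/-! ### Mixed partial derivatives of the kernel -/

section MixedPartials

variable {d : ℕ} {Ω : Set (EuclideanSpace ℝ (Fin d))} {p : ℝ}
  {k : EuclideanSpace ℝ (Fin d) → EuclideanSpace ℝ (Fin d) → ℝ}

theorem MemCC.hasLineDerivAt_left (hk : MemCC Ω p k) {a : Fin d} {l l' : List (Fin d)}
    (hl : (a :: l).length ≤ ⌊p⌋₊) (hl' : l'.length ≤ ⌊p⌋₊) {u v : EuclideanSpace ℝ (Fin d)}
    (hu : u ∈ Ω) (hv : v ∈ Ω) :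
    HasLineDerivAt ℝ (fun w => mixedPartial l l' k w v) (mixedPartial (a :: l) l' k u v) u
      (EuclideanSpace.single a 1) :=
  (((hk (a :: l) l' hl hl').2.1 v hv).2 u hu).hasLineDerivAt

theorem MemCC.continuousOn (hk : MemCC Ω p k) {l l' : List (Fin d)}
    (hl : l.length ≤ ⌊p⌋₊) (hl' : l'.length ≤ ⌊p⌋₊) :
    ContinuousOn (fun z : EuclideanSpace ℝ (Fin d) × EuclideanSpace ℝ (Fin d) =>
      mixedPartial l l' k z.1 z.2) (Ω ×ˢ Ω) :=
  (hk l l' hl hl').2.2.1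

/-- `MemCC` differentiates in the second argument only before any derivative in the first is taken.
Each derivative in the first argument is therefore moved past `∂_b` by `hasLineDerivAt_swap`,
inductively in `l`. -/
theorem MemCC.hasLineDerivAt_right (hΩ : IsOpen Ω) (hk : MemCC Ω p k) {b : Fin d}
    {l l' : List (Fin d)} (hl : l.length ≤ ⌊p⌋₊) (hl' : (b :: l').length ≤ ⌊p⌋₊)
    {u v : EuclideanSpace ℝ (Fin d)} (hu : u ∈ Ω) (hv : v ∈ Ω) :
    HasLineDerivAt ℝ (mixedPartial l l' k u) (mixedPartial l (b :: l') k u v) v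
      (EuclideanSpace.single b 1) := by
  have hl'' : l'.length ≤ ⌊p⌋₊ := (Nat.le_succ _).trans hl'
  induction l generalizing u v with
  | nil => exact (((hk [] (b :: l') hl hl').1 u hu).2 v hv).hasLineDerivAt
  | cons a l ih =>
    exact hasLineDerivAt_swap hΩ (f := mixedPartial l l' k) (f₂ := mixedPartial l (b :: l') k)
      (fun u hu v hv => hk.hasLineDerivAt_left hl hl'' hu hv)
      (fun u hu v hv => ih ((Nat.le_succ _).trans hl) hu hv)
      (fun u hu v hv => hk.hasLineDerivAt_left hl hl' hu hv)
      (hk.continuousOn hl hl') hu hv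

end MixedPartials

/-! ### Differentiability in a Hilbert space through inner products -/

section HilbertDerivatives

variable {E H : Type*} [NormedAddCommGroup E] [NormedSpace ℝ E]
  [NormedAddCommGroup H] [InnerProductSpace ℝ H]

/-- Loève's criterion. In `‖a - b‖² = ⟪a, a⟫ - 2 ⟪a, b⟫ + ⟪b, b⟫` the limits `c` cancel, so the
quotients are Cauchy; the weights 1, 2, 1 explain the tolerance `ε ^ 2 / 4`. -/
theorem lineDifferentiableAt_of_inner_tendsto [CompleteSpace H] {G : E → H} {u e : E} {c : ℝ}
    (h : ∀ ε > 0, ∃ δ > 0, ∀ s t : ℝ, s ≠ 0 → t ≠ 0 → |s| < δ → |t| < δ →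
      |inner ℝ (s⁻¹ • (G (u + s • e) - G u)) (t⁻¹ • (G (u + t • e) - G u)) - c| < ε) :
    LineDifferentiableAt ℝ G u e := by
  have hcau : Cauchy (map (fun s : ℝ => s⁻¹ • (G (u + s • e) - G u)) (𝓝[≠] 0)) := by
    rw [Metric.cauchy_iff]
    refine ⟨inferInstance, fun ε hε => ?_⟩
    obtain ⟨δ, hδ, h⟩ := h (ε ^ 2 / 4) (by positivity)
    refine ⟨(fun s : ℝ => s⁻¹ • (G (u + s • e) - G u)) '' (Metric.ball 0 δ ∩ {0}ᶜ),
      image_mem_map (inter_mem (nhdsWithin_le_nhds (Metric.ball_mem_nhds _ hδ))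
        self_mem_nhdsWithin), ?_⟩
    rintro _ ⟨s, ⟨hs, hs0⟩, rfl⟩ _ ⟨t, ⟨ht, ht0⟩, rfl⟩
    rw [Metric.mem_ball, Real.dist_0_eq_abs] at hs ht
    have h1 := abs_lt.1 (h s s hs0 hs0 hs hs)
    have h2 := abs_lt.1 (h s t hs0 ht0 hs ht)
    have h3 := abs_lt.1 (h t t ht0 ht0 ht ht)
    have h4 : dist (s⁻¹ • (G (u + s • e) - G u)) (t⁻¹ • (G (u + t • e) - G u)) ^ 2 < ε ^ 2 := by
      rw [dist_eq_norm, norm_sub_sq_real, ← real_inner_self_eq_norm_sq,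
        ← real_inner_self_eq_norm_sq]
      linarith [h1.1, h1.2, h2.1, h2.2, h3.1, h3.2]
    exact lt_of_pow_lt_pow_left₀ 2 hε.le h4
  obtain ⟨L, hL⟩ := cauchy_map_iff_exists_tendsto.1 hcau
  exact (hasLineDerivAt_iff_tendsto_slope_zero.2 hL).lineDifferentiableAt

theorem lineDeriv_mem_of_isClosed {F : Type*} [NormedAddCommGroup F] [NormedSpace ℝ F]
    {Ω : Set E} (hΩ : IsOpen Ω) {V : Submodule ℝ F} (hV : IsClosed (V : Set F)) {G : E → F}
    (hG : ∀ u ∈ Ω, G u ∈ V) {u e : E} (hu : u ∈ Ω) : lineDeriv ℝ G u e ∈ V := by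
  by_cases hd : LineDifferentiableAt ℝ G u e
  · refine hV.mem_of_tendsto (hasLineDerivAt_iff_tendsto_slope_zero.1 hd.hasLineDerivAt) ?_
    filter_upwards [nhdsWithin_le_nhds (eventually_line_mem hΩ hu e)] with t ht
    exact V.smul_mem _ (V.sub_mem (hG _ (ht t le_rfl)) (hG u hu))
  -- The default value `0` of `lineDeriv` also lies in `V`.
  · rw [lineDeriv_zero_of_not_lineDifferentiableAt hd]
    exact V.zero_mem

end HilbertDerivatives

/-! ### Derivatives of the process in quadratic mean -/

section VecIterPartial

variable {d : ℕ} {H : Type*} [NormedAddCommGroup H]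

/-- Iterated partial derivatives of a vector-valued function. -/
noncomputable def vecIterPartial [NormedSpace ℝ H] (G : EuclideanSpace ℝ (Fin d) → H) :
    List (Fin d) → EuclideanSpace ℝ (Fin d) → H
  | [] => G
  | a :: l => fun u => lineDeriv ℝ (vecIterPartial G l) u (EuclideanSpace.single a 1)

theorem vecIterPartial_mem [NormedSpace ℝ H] {Ω : Set (EuclideanSpace ℝ (Fin d))}
    (hΩ : IsOpen Ω) {G : EuclideanSpace ℝ (Fin d) → H} {V : Submodule ℝ H}
    (hV : IsClosed (V : Set H)) (hG : ∀ u ∈ Ω, G u ∈ V) (l : List (Fin d)) :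
    ∀ u ∈ Ω, vecIterPartial G l u ∈ V := by
  induction l with
  | nil => exact hG
  | cons a l ih => exact fun u hu => lineDeriv_mem_of_isClosed hΩ hV ih hu

variable [InnerProductSpace ℝ H] [CompleteSpace H] {Ω : Set (EuclideanSpace ℝ (Fin d))} {p : ℝ}
  {k : EuclideanSpace ℝ (Fin d) → EuclideanSpace ℝ (Fin d) → ℝ}
  {G : EuclideanSpace ℝ (Fin d) → H}

/-- Inner products of difference quotients of `D^l G` are double difference quotients of `D^{l,l}
k`, which converge to `D^{a::l,a::l} k` at `(u, u)`. -/
theorem MemCC.lineDifferentiableAt_vecIterPartial (hΩ : IsOpen Ω) (hk : MemCC Ω p k)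
    {a : Fin d} {l : List (Fin d)} (hl : (a :: l).length ≤ ⌊p⌋₊)
    (hG : ∀ u ∈ Ω, ∀ v ∈ Ω,
      inner ℝ (vecIterPartial G l u) (vecIterPartial G l v) = mixedPartial l l k u v)
    {u : EuclideanSpace ℝ (Fin d)} (hu : u ∈ Ω) :
    LineDifferentiableAt ℝ (vecIterPartial G l) u (EuclideanSpace.single a 1) := by
  have hl' : l.length ≤ ⌊p⌋₊ := (Nat.le_succ _).trans hl
  refine lineDifferentiableAt_of_inner_tendsto (c := mixedPartial (a :: l) (a :: l) k u u)
    fun ε hε => ?_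
  obtain ⟨δ₁, hδ₁, h1⟩ := tendsto_double_difference hΩ
    (fun u hu v hv => hk.hasLineDerivAt_right hΩ hl' hl hu hv)
    (fun u hu v hv => hk.hasLineDerivAt_left hl hl hu hv) (hk.continuousOn hl hl) hu hu hε
  obtain ⟨δ₂, hδ₂, h2⟩ := Metric.eventually_nhds_iff.1
    (eventually_line_mem hΩ hu (EuclideanSpace.single a (1 : ℝ)))
  refine ⟨min δ₁ δ₂, by positivity, fun s t hs0 ht0 hs ht => ?_⟩
  have hs2 := @h2 s (by rw [Real.dist_0_eq_abs]; exact hs.trans_le (min_le_right _ _)) s le_rfl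
  have ht2 := @h2 t (by rw [Real.dist_0_eq_abs]; exact ht.trans_le (min_le_right _ _)) t le_rfl
  convert h1 s t hs0 ht0 (hs.trans_le (min_le_left _ _)) (ht.trans_le (min_le_left _ _)) using 3
  rw [real_inner_smul_left, real_inner_smul_right, inner_sub_left, inner_sub_right,
    inner_sub_right, hG _ hs2 _ ht2, hG _ hs2 _ hu, hG _ hu _ ht2, hG _ hu _ hu]
  ring

/-- The identity at order `l` yields differentiability of `D^l G`; differentiating it in `u` and
then in `v` yields the identity at the next order. -/
theorem MemCC.inner_vecIterPartial (hΩ : IsOpen Ω) (hk : MemCC Ω p k)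
    (hG : ∀ u ∈ Ω, ∀ v ∈ Ω, inner ℝ (G u) (G v) = k u v)
    {l : List (Fin d)} (hl : l.length ≤ ⌊p⌋₊) :
    ∀ u ∈ Ω, ∀ v ∈ Ω,
      inner ℝ (vecIterPartial G l u) (vecIterPartial G l v) = mixedPartial l l k u v := by
  induction l with
  | nil => exact hG
  | cons a l ih =>
    have hl' : l.length ≤ ⌊p⌋₊ := (Nat.le_succ _).trans hl
    specialize ih hl'
    have hd : ∀ u ∈ Ω, HasLineDerivAt ℝ (vecIterPartial G l) (vecIterPartial G (a :: l) u) u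
        (EuclideanSpace.single a 1) := fun u hu =>
      (hk.lineDifferentiableAt_vecIterPartial hΩ hl ih hu).hasLineDerivAt
    have h1 : ∀ u ∈ Ω, ∀ v ∈ Ω, inner ℝ (vecIterPartial G (a :: l) u) (vecIterPartial G l v) =
        mixedPartial (a :: l) l k u v := fun u hu v hv => by
      have e1 : HasLineDerivAt ℝ (fun w => inner ℝ (vecIterPartial G l w) (vecIterPartial G l v))
          (inner ℝ (vecIterPartial G (a :: l) u) (vecIterPartial G l v)) u
          (EuclideanSpace.single a 1) := by
        have := HasDerivAt.inner ℝ (hd u hu) (hasDerivAt_const (0 : ℝ) (vecIterPartial G l v))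
        unfold HasLineDerivAt
        simpa using this
      refine e1.unique ((hk.hasLineDerivAt_left hl hl' hu hv).congr_of_eventuallyEq ?_)
      filter_upwards [hΩ.mem_nhds hu] with w hw using ih w hw v hv
    intro u hu v hv
    have e1 : HasLineDerivAt ℝ (fun w => inner ℝ (vecIterPartial G (a :: l) u)
        (vecIterPartial G l w)) (inner ℝ (vecIterPartial G (a :: l) u)
          (vecIterPartial G (a :: l) v)) v (EuclideanSpace.single a 1) := by
      have := HasDerivAt.inner ℝ (hasDerivAt_const (0 : ℝ) (vecIterPartial G (a :: l) u)) (hd v hv)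
      unfold HasLineDerivAt
      simpa using this
    refine e1.unique ((hk.hasLineDerivAt_right hΩ hl hl hu hv).congr_of_eventuallyEq ?_)
    filter_upwards [hΩ.mem_nhds hv] with w hw using h1 u hu w hw

theorem MemCC.hasLineDerivAt_vecIterPartial (hΩ : IsOpen Ω) (hk : MemCC Ω p k)
    (hG : ∀ u ∈ Ω, ∀ v ∈ Ω, inner ℝ (G u) (G v) = k u v)
    {a : Fin d} {l : List (Fin d)} (hl : (a :: l).length ≤ ⌊p⌋₊)
    {u : EuclideanSpace ℝ (Fin d)} (hu : u ∈ Ω) :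
    HasLineDerivAt ℝ (vecIterPartial G l) (vecIterPartial G (a :: l) u) u
      (EuclideanSpace.single a 1) :=
  (hk.lineDifferentiableAt_vecIterPartial hΩ hl
    (hk.inner_vecIterPartial hΩ hG ((Nat.le_succ _).trans hl)) hu).hasLineDerivAt

theorem MemCC.norm_sub_sq_vecIterPartial (hΩ : IsOpen Ω) (hk : MemCC Ω p k)
    (hG : ∀ u ∈ Ω, ∀ v ∈ Ω, inner ℝ (G u) (G v) = k u v)
    {l : List (Fin d)} (hl : l.length ≤ ⌊p⌋₊) {u v : EuclideanSpace ℝ (Fin d)} (hu : u ∈ Ω)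
    (hv : v ∈ Ω) :
    ‖vecIterPartial G l u - vecIterPartial G l v‖ ^ 2 =
      mixedPartial l l k u u - mixedPartial l l k u v -
        (mixedPartial l l k v u - mixedPartial l l k v v) := by
  have h := hk.inner_vecIterPartial hΩ hG hl
  rw [← real_inner_self_eq_norm_sq, inner_sub_left, inner_sub_right, inner_sub_right,
    h u hu u hu, h u hu v hv, h v hv u hu, h v hv v hv]

theorem MemCC.continuousOn_vecIterPartial (hΩ : IsOpen Ω) (hk : MemCC Ω p k)
    (hG : ∀ u ∈ Ω, ∀ v ∈ Ω, inner ℝ (G u) (G v) = k u v)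
    {l : List (Fin d)} (hl : l.length ≤ ⌊p⌋₊) : ContinuousOn (vecIterPartial G l) Ω := by
  intro u hu
  refine ContinuousAt.continuousWithinAt ?_
  have hK : ContinuousAt (fun z : EuclideanSpace ℝ (Fin d) × EuclideanSpace ℝ (Fin d) =>
      mixedPartial l l k z.1 z.2) (u, u) :=
    (hk.continuousOn hl hl).continuousAt ((hΩ.prod hΩ).mem_nhds ⟨hu, hu⟩)
  have h1 : Tendsto (fun v => mixedPartial l l k v v) (𝓝 u) (𝓝 (mixedPartial l l k u u)) :=
    hK.tendsto.comp (f := fun v => (v, v)) (Continuous.tendsto (by fun_prop) u)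
  have h2 : Tendsto (fun v => mixedPartial l l k v u) (𝓝 u) (𝓝 (mixedPartial l l k u u)) :=
    hK.tendsto.comp (f := fun v => (v, u)) (Continuous.tendsto (by fun_prop) u)
  have h3 : Tendsto (fun v => mixedPartial l l k u v) (𝓝 u) (𝓝 (mixedPartial l l k u u)) :=
    hK.tendsto.comp (f := fun v => (u, v)) (Continuous.tendsto (by fun_prop) u)
  have h4 : Tendsto (fun v => ‖vecIterPartial G l v - vecIterPartial G l u‖ ^ 2) (𝓝 u) (𝓝 0) := by
    have h5 := (h1.sub h2).sub (h3.sub (tendsto_const_nhds (x := mixedPartial l l k u u)))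
    simp only [sub_self] at h5
    refine h5.congr' ?_
    filter_upwards [hΩ.mem_nhds hu] with v hv
    rw [hk.norm_sub_sq_vecIterPartial hΩ hG hl hv hu]
  have h6 := h4.sqrt
  simp only [Real.sqrt_zero, Real.sqrt_sq (norm_nonneg _)] at h6
  exact tendsto_iff_norm_sub_tendsto_zero.2 h6

theorem MemCC.exists_norm_vecIterPartial_le (hΩ : IsOpen Ω) (hk : MemCC Ω p k)
    (hG : ∀ u ∈ Ω, ∀ v ∈ Ω, inner ℝ (G u) (G v) = k u v)
    {l : List (Fin d)} (hl : l.length ≤ ⌊p⌋₊) :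
    ∃ B : ℝ, 0 ≤ B ∧ ∀ u ∈ Ω, ‖vecIterPartial G l u‖ ≤ B := by
  obtain ⟨M, hM⟩ := (hk l l hl hl).2.2.2.1
  refine ⟨√M, Real.sqrt_nonneg _, fun u hu => Real.le_sqrt_of_sq_le ?_⟩
  rw [← real_inner_self_eq_norm_sq, hk.inner_vecIterPartial hΩ hG hl u hu u hu]
  exact (le_abs_self _).trans (hM (u, u) ⟨hu, hu⟩)

/-- The squared increment is a difference of two kernel increments, each Hölder with exponent `p -
⌊p⌋` and constant `C`. The square root halves the exponent and gives `√(2 * C)`. -/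
theorem MemCC.exists_norm_sub_vecIterPartial_le_rpow (hΩ : IsOpen Ω) (hk : MemCC Ω p k)
    (hG : ∀ u ∈ Ω, ∀ v ∈ Ω, inner ℝ (G u) (G v) = k u v)
    {l : List (Fin d)} (hl : l.length ≤ ⌊p⌋₊) (hp : 0 < p - ⌊p⌋₊) :
    ∃ L : ℝ, 0 ≤ L ∧ ∀ u ∈ Ω, ∀ v ∈ Ω, ‖vecIterPartial G l u - vecIterPartial G l v‖ ≤
      L * dist u v ^ ((p - ⌊p⌋₊) / 2) := by
  obtain ⟨C, hC⟩ := (hk l l hl hl).2.2.2.2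
  refine ⟨√(2 * C), Real.sqrt_nonneg _, fun u hu v hv => ?_⟩
  have h1 := hC.dist_le (x := (u, u)) (y := (u, v)) ⟨hu, hu⟩ ⟨hu, hv⟩
  have h2 := hC.dist_le (x := (v, u)) (y := (v, v)) ⟨hv, hu⟩ ⟨hv, hv⟩
  rw [Real.dist_eq, Prod.dist_eq, dist_self, max_eq_right dist_nonneg,
    Real.coe_toNNReal _ hp.le] at h1 h2
  have h3 := hk.norm_sub_sq_vecIterPartial hΩ hG hl hu hv
  have h4 : dist u v ^ ((p - ⌊p⌋₊) / 2) = √(dist u v ^ (p - ⌊p⌋₊)) := by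
    rw [Real.sqrt_eq_rpow, ← Real.rpow_mul dist_nonneg]
    ring_nf
  rw [h4, ← Real.sqrt_mul (by positivity)]
  refine Real.le_sqrt_of_sq_le ?_
  rw [h3]
  linarith [(abs_le.1 h1).2, (abs_le.1 h2).1]

end VecIterPartial

/-! ### From bounded partial derivatives to Lipschitz bounds along segments -/

section LipschitzAlongSegments

/-- A function whose local dilation is at most `L` everywhere on an interval is `L`-Lipschitz. -/
theorem norm_sub_le_of_local_lipschitz {F : Type*} [NormedAddCommGroup F] {φ : ℝ → F} {L : ℝ}
    (h : ∀ s ∈ Icc (0 : ℝ) 1, ∀ᶠ t in 𝓝 s, ‖φ t - φ s‖ ≤ L * |t - s|) : ‖φ 1 - φ 0‖ ≤ L := by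
  have hc : ContinuousOn (fun s => ‖φ s - φ 0‖) (Icc 0 1) := by
    intro s hs
    refine ContinuousAt.continuousWithinAt ?_
    have : ContinuousAt φ s := by
      refine tendsto_iff_norm_sub_tendsto_zero.2 ?_
      have h0 : Tendsto (fun t => L * |t - s|) (𝓝 s) (𝓝 0) := by
        have : Continuous fun t : ℝ => L * |t - s| := by fun_prop
        simpa using this.tendsto s
      exact squeeze_zero' (Eventually.of_forall fun _ => norm_nonneg _) (h s hs) h0
    fun_prop
  -- Comparison of `‖φ s - φ 0‖` with `L * s`, using only upper bounds on slopes, since `φ` need not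
  -- be differentiable.
  have := image_le_of_liminf_slope_right_le_deriv_boundary (f := fun s => ‖φ s - φ 0‖) (a := 0)
    (b := 1) hc (B := fun s => L * s) (B' := fun _ => L) (by simp) (by fun_prop)
    (fun x _ => by simpa using ((hasDerivAt_id x).const_mul L).hasDerivWithinAt)
    (fun x hx r hr => by
      refine Eventually.frequently ?_
      filter_upwards [self_mem_nhdsWithin, nhdsWithin_le_nhds (h x ⟨hx.1, hx.2.le⟩)] with z hz h2
      have hz : 0 < z - x := sub_pos.2 hz
      rw [slope_def_field, div_lt_iff₀ hz]
      rw [abs_of_pos hz] at h2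
      have h3 := norm_sub_norm_le (φ z - φ 0) (φ x - φ 0)
      rw [sub_sub_sub_cancel_right] at h3
      have := mul_lt_mul_of_pos_right hr hz
      linarith) (x := 1) (by simp)
  simpa using this

variable {d : ℕ} {F : Type*} [NormedAddCommGroup F] [NormedSpace ℝ F]
  {Ω : Set (EuclideanSpace ℝ (Fin d))}

theorem EuclideanSpace.abs_apply_le_norm (x : EuclideanSpace ℝ (Fin d)) (a : Fin d) :
    |x a| ≤ ‖x‖ := by
  rw [← Real.norm_eq_abs]
  exact PiLp.norm_apply_le x a

/-- Bounded partial derivatives bound the increments, along a path parallel to the axes. -/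
theorem norm_sub_le_of_partial_bound {G : EuclideanSpace ℝ (Fin d) → F}
    {G' : Fin d → EuclideanSpace ℝ (Fin d) → F} {B : ℝ} (hB : 0 ≤ B)
    (hG : ∀ a, ∀ u ∈ Ω, HasLineDerivAt ℝ G (G' a u) u (EuclideanSpace.single a 1))
    (hG' : ∀ a, ∀ u ∈ Ω, ‖G' a u‖ ≤ B) {y z : EuclideanSpace ℝ (Fin d)} {r : ℝ}
    (hr : Metric.ball y r ⊆ Ω) (hz : d * ‖z - y‖ < r) : ‖G z - G y‖ ≤ d * B * ‖z - y‖ := by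
  classical
  have key : ∀ S : Finset (Fin d),
      ‖G (y + ∑ b ∈ S, (z - y) b • EuclideanSpace.single b (1 : ℝ)) - G y‖ ≤
        S.card * (B * ‖z - y‖) := by
    intro S
    induction S using Finset.induction_on with
    | empty => simp
    | insert a S ha ih =>
      set w := y + ∑ b ∈ S, (z - y) b • EuclideanSpace.single b (1 : ℝ) with hw
      have hcard : (insert a S).card ≤ d := by
        simpa using Finset.card_le_univ (insert a S)
      rw [Finset.card_insert_of_notMem ha] at hcard ⊢
      -- The path makes at most `d` axis-parallel moves of length at most `‖z - y‖`, so `hz` keeps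
      -- it inside the ball.
      have hmem : ∀ s ∈ uIcc 0 ((z - y) a), w + s • EuclideanSpace.single a (1 : ℝ) ∈ Ω := by
        intro s hs
        refine hr ?_
        have hs' : |s| ≤ ‖z - y‖ := by
          refine le_trans ?_ (EuclideanSpace.abs_apply_le_norm (z - y) a)
          have := abs_sub_left_of_mem_uIcc hs
          simpa using this
        rw [Metric.mem_ball, dist_eq_norm, hw, add_assoc, add_sub_cancel_left]
        calc _ ≤ ‖∑ b ∈ S, (z - y) b • EuclideanSpace.single b (1 : ℝ)‖ +
              ‖s • EuclideanSpace.single a (1 : ℝ)‖ := norm_add_le _ _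
          _ ≤ ∑ _b ∈ S, ‖z - y‖ + ‖z - y‖ := by
              gcongr
              · refine (norm_sum_le _ _).trans (Finset.sum_le_sum fun b _ => ?_)
                rw [norm_smul, PiLp.norm_single, norm_one, mul_one, Real.norm_eq_abs]
                exact EuclideanSpace.abs_apply_le_norm (z - y) b
              · rw [norm_smul, PiLp.norm_single, norm_one, mul_one, Real.norm_eq_abs]
                exact hs'
          _ = ((S.card + 1 : ℕ) : ℝ) * ‖z - y‖ := by
              rw [Finset.sum_const, nsmul_eq_mul]; push_cast; ring
          _ ≤ d * ‖z - y‖ := by gcongr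
          _ < r := hz
      have hstep : ‖G (w + (z - y) a • EuclideanSpace.single a (1 : ℝ)) - G w‖ ≤
          B * ‖z - y‖ := by
        have := (convex_uIcc (0 : ℝ) ((z - y) a)).norm_image_sub_le_of_norm_hasDerivWithin_le
          (f := fun s : ℝ => G (w + s • EuclideanSpace.single a (1 : ℝ))) (C := B)
          (fun s hs => (hG a _ (hmem s hs)).hasDerivAt_line.hasDerivWithinAt)
          (fun s hs => hG' a _ (hmem s hs)) left_mem_uIcc right_mem_uIcc
        simp only [zero_smul, add_zero, sub_zero, Real.norm_eq_abs] at this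
        refine this.trans ?_
        gcongr
        exact EuclideanSpace.abs_apply_le_norm (z - y) a
      rw [Finset.sum_insert ha, add_comm (_ • _), ← add_assoc, ← hw]
      calc _ = ‖(G (w + (z - y) a • EuclideanSpace.single a (1 : ℝ)) - G w) + (G w - G y)‖ := by
            rw [sub_add_sub_cancel]
        _ ≤ B * ‖z - y‖ + S.card * (B * ‖z - y‖) := (norm_add_le _ _).trans (add_le_add hstep ih)
        _ = _ := by push_cast; ring
  have hsum : y + ∑ b, (z - y) b • EuclideanSpace.single b (1 : ℝ) = z := by
    have : ∑ b, (z - y) b • EuclideanSpace.single b (1 : ℝ) = z - y := by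
      ext i
      simp [Finset.sum_apply, Pi.single_apply]
    rw [this]; abel
  have := key Finset.univ
  rw [hsum] at this
  simpa [mul_assoc] using this

/-- Only partial derivatives along the axes are given, so a slanted segment is handled locally:
axis-parallel paths in small balls bound the local dilation, and `norm_sub_le_of_local_lipschitz`
globalises with the same constant. -/
theorem norm_sub_le_of_segment_subset (hΩ : IsOpen Ω) {G : EuclideanSpace ℝ (Fin d) → F}
    {G' : Fin d → EuclideanSpace ℝ (Fin d) → F} {B : ℝ} (hB : 0 ≤ B)
    (hG : ∀ a, ∀ u ∈ Ω, HasLineDerivAt ℝ G (G' a u) u (EuclideanSpace.single a 1))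
    (hG' : ∀ a, ∀ u ∈ Ω, ‖G' a u‖ ≤ B) {x z : EuclideanSpace ℝ (Fin d)}
    (hxz : ∀ s ∈ Icc (0 : ℝ) 1, x + s • z ∈ Ω) : ‖G (x + z) - G x‖ ≤ d * B * ‖z‖ := by
  have := norm_sub_le_of_local_lipschitz (φ := fun s : ℝ => G (x + s • z)) (L := d * B * ‖z‖)
    (fun s hs => by
      obtain ⟨r, hr, hsub⟩ := Metric.isOpen_iff.1 hΩ _ (hxz s hs)
      have hlim : Tendsto (fun t : ℝ => d * ‖(x + t • z) - (x + s • z)‖) (𝓝 s) (𝓝 0) := by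
        have : Continuous fun t : ℝ => d * ‖(x + t • z) - (x + s • z)‖ := by fun_prop
        simpa using this.tendsto s
      filter_upwards [hlim.eventually_lt_const hr] with t ht
      refine (norm_sub_le_of_partial_bound hB hG hG' hsub ht).trans (le_of_eq ?_)
      rw [add_sub_add_left_eq_sub, ← sub_smul, norm_smul, Real.norm_eq_abs]
      ring)
  simpa using this

end LipschitzAlongSegments

/-! ### Geometry of the interior cone condition -/

section ConePieces

variable {d : ℕ} {Ω : Set (EuclideanSpace ℝ (Fin d))}

/-- The points of `Ω` that are the apex of a cone inside `Ω` with axis `ξ`, height `r` and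
opening `{z | c ‖z‖ ≤ ⟪z, ξ⟫}`. -/
def coneApexes (Ω : Set (EuclideanSpace ℝ (Fin d))) (c r : ℝ) (ξ : EuclideanSpace ℝ (Fin d)) :
    Set (EuclideanSpace ℝ (Fin d)) :=
  {x ∈ Ω | ∀ z : EuclideanSpace ℝ (Fin d), ‖z‖ ≤ r → c * ‖z‖ ≤ inner ℝ z ξ → x + z ∈ Ω}

/-- Finitely many directions suffice in the interior cone condition. -/
theorem InteriorConeCondition.exists_finite_directions (hΩ : InteriorConeCondition Ω) :
    ∃ c ∈ Ioo (0 : ℝ) 1, ∃ r > (0 : ℝ), ∃ D : Set (EuclideanSpace ℝ (Fin d)), D.Finite ∧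
      (∀ ξ ∈ D, ‖ξ‖ = 1) ∧ ∀ x ∈ Ω, ∃ ξ ∈ D, x ∈ coneApexes Ω c r ξ := by
  obtain ⟨θ, hθ, r, hr, h⟩ := hΩ
  have hcos0 : 0 < Real.cos θ := Real.cos_pos_of_mem_Ioo ⟨by linarith [hθ.1, Real.pi_pos], hθ.2⟩
  have hcos1 : Real.cos θ < 1 := by
    rw [← Real.cos_zero]
    exact Real.cos_lt_cos_of_nonneg_of_le_pi_div_two le_rfl hθ.2.le hθ.1
  -- Moving the axis by less than `(1 - cos θ) / 2` changes `⟪z, ξ⟫` by at most that multiple of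
  -- `‖z‖`. Raising the threshold from `cos θ` to `(1 + cos θ) / 2` compensates for this.
  obtain ⟨D, hDsub, hDfin, hDcov⟩ := Metric.finite_approx_of_totallyBounded
    (isCompact_sphere (0 : EuclideanSpace ℝ (Fin d)) 1).totallyBounded ((1 - Real.cos θ) / 2)
    (by linarith)
  refine ⟨(1 + Real.cos θ) / 2, ⟨by linarith, by linarith⟩, r, hr, D, hDfin,
    fun ξ hξ => by simpa using hDsub hξ, fun x hx => ?_⟩
  obtain ⟨ξ, hξ, hcone⟩ := h x hx
  obtain ⟨ξ', hξ', hdist⟩ := mem_iUnion₂.1 (hDcov (show ξ ∈ Metric.sphere 0 1 by simpa using hξ))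
  refine ⟨ξ', hξ', hx, fun z hz hin => ?_⟩
  rcases eq_or_ne z 0 with rfl | hz0
  · simpa using hx
  have hzpos : 0 < ‖z‖ := norm_pos_iff.2 hz0
  rw [Metric.mem_ball, dist_eq_norm] at hdist
  have h1 : inner ℝ z (ξ' - ξ) ≤ ‖z‖ * ((1 - Real.cos θ) / 2) := by
    refine (real_inner_le_norm _ _).trans ?_
    rw [norm_sub_rev]
    gcongr
  rw [inner_sub_right] at h1
  have h2 := hcone (‖z‖⁻¹ • z) (by rw [norm_smul, norm_inv, norm_norm, inv_mul_cancel₀ hzpos.ne'])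
    (by
      rw [real_inner_smul_left, ← div_eq_inv_mul, le_div_iff₀ hzpos]
      linarith) ‖z‖ ⟨hzpos.le, hz⟩
  rwa [smul_inv_smul₀ hzpos.ne'] at h2

/-- On apexes of cones with a common axis that are close together, functions that are Lipschitz
along segments inside `Ω` are Lipschitz. -/
theorem norm_sub_le_of_mem_coneApexes {F : Type*} [NormedAddCommGroup F]
    {G : EuclideanSpace ℝ (Fin d) → F} {L c r : ℝ} (hL : 0 ≤ L) (hc : c ∈ Ioo (0 : ℝ) 1)
    (hG : ∀ x z : EuclideanSpace ℝ (Fin d), (∀ s ∈ Icc (0 : ℝ) 1, x + s • z ∈ Ω) →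
      ‖G (x + z) - G x‖ ≤ L * ‖z‖)
    {ξ x y : EuclideanSpace ℝ (Fin d)} (hξ : ‖ξ‖ = 1) (hx : x ∈ coneApexes Ω c r ξ)
    (hy : y ∈ coneApexes Ω c r ξ) (hxy : (2 / (1 - c) + 1) * ‖x - y‖ ≤ r) :
    ‖G x - G y‖ ≤ L * (4 / (1 - c) + 1) * ‖x - y‖ := by
  have hc1 : 0 < 1 - c := by linarith [hc.2]
  have hseg : ∀ x ∈ coneApexes Ω c r ξ, ∀ z : EuclideanSpace ℝ (Fin d), ‖z‖ ≤ r →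
      c * ‖z‖ ≤ inner ℝ z ξ → ‖G (x + z) - G x‖ ≤ L * ‖z‖ := by
    intro x hx z hz hin
    refine hG x z fun s hs => hx.2 _ ?_ ?_
    · rw [norm_smul, Real.norm_of_nonneg hs.1]
      exact (mul_le_of_le_one_left (norm_nonneg _) hs.2).trans hz
    · rw [norm_smul, Real.norm_of_nonneg hs.1, real_inner_smul_left, mul_left_comm]
      exact mul_le_mul_of_nonneg_left hin hs.1
  set ρ := ‖x - y‖ with hρ
  have hρ0 : 0 ≤ ρ := norm_nonneg _
  -- The two cones share the point `x + τ • ξ`. Seen from `y`, it lies in the cone once `c * (ρ + τ)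
  -- ≤ τ - ρ`, which this `τ` ensures. The detour has length at most `2 * τ + ρ`, whence the
  -- constant.
  set τ := 2 / (1 - c) * ρ with hτ
  have hτ0 : 0 ≤ τ := by positivity
  have hτc : τ * (1 - c) = 2 * ρ := by rw [hτ]; field_simp
  have hτr : τ + ρ ≤ r := by rw [hτ]; linarith
  have hn1 : ‖τ • ξ‖ = τ := by rw [norm_smul, hξ, mul_one, Real.norm_of_nonneg hτ0]
  have hn2 : ‖x - y + τ • ξ‖ ≤ ρ + τ := (norm_add_le _ _).trans (by rw [hn1])
  have h1 := hseg x hx (τ • ξ) (by rw [hn1]; linarith) (by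
    rw [hn1, real_inner_smul_left, real_inner_self_eq_norm_sq, hξ]
    nlinarith [hc.2])
  have h2 := hseg y hy (x - y + τ • ξ) (hn2.trans (by linarith)) (by
    rw [inner_add_left, real_inner_smul_left, real_inner_self_eq_norm_sq, hξ]
    have h3 : -ρ ≤ inner ℝ (x - y) ξ := by
      have := (abs_le.1 (abs_real_inner_le_norm (x - y) ξ)).1
      rwa [hξ, mul_one] at this
    have h4 := mul_le_mul_of_nonneg_left hn2 hc.1.le
    nlinarith [hc.2])
  have e : y + (x - y + τ • ξ) = x + τ • ξ := by abel
  rw [e] at h2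
  calc ‖G x - G y‖ = ‖(G (x + τ • ξ) - G y) - (G (x + τ • ξ) - G x)‖ := by congr 1; abel
    _ ≤ L * ‖x - y + τ • ξ‖ + L * ‖τ • ξ‖ := (norm_sub_le _ _).trans (add_le_add h2 h1)
    _ ≤ L * (ρ + τ) + L * τ := by rw [hn1]; gcongr
    _ = L * (4 / (1 - c) + 1) * ρ := by rw [hτ]; ring

/-- `Ω` is a finite union of sets on which every function that is Lipschitz along segments inside
`Ω` is Lipschitz. -/
theorem InteriorConeCondition.exists_finite_cover (hcone : InteriorConeCondition Ω)
    (hbdd : Bornology.IsBounded Ω) {F : Type*} [NormedAddCommGroup F] :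
    ∃ 𝒜 : Set (Set (EuclideanSpace ℝ (Fin d))), 𝒜.Finite ∧ (∀ A ∈ 𝒜, A ⊆ Ω) ∧ Ω ⊆ ⋃₀ 𝒜 ∧
      ∃ K : ℝ, 0 ≤ K ∧ ∀ A ∈ 𝒜, ∀ (G : EuclideanSpace ℝ (Fin d) → F) (L : ℝ), 0 ≤ L →
        (∀ x z : EuclideanSpace ℝ (Fin d), (∀ s ∈ Icc (0 : ℝ) 1, x + s • z ∈ Ω) →
          ‖G (x + z) - G x‖ ≤ L * ‖z‖) →
        ∀ x ∈ A, ∀ y ∈ A, ‖G x - G y‖ ≤ L * K * ‖x - y‖ := by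
  obtain ⟨c, hc, r, hr, D, hDfin, hD1, hD⟩ := hcone.exists_finite_directions
  have hc1 : 0 < 1 - c := by linarith [hc.2]
  have htb : TotallyBounded Ω := 
    hbdd.isCompact_closure.totallyBounded.subset subset_closure
  -- Two points of one `δ`-ball are at most `2 * δ` apart, which is exactly what the height `r` of
  -- the cones allows.
  set δ : ℝ := r / (2 / (1 - c) + 1) / 2 with hδ
  have hδ0 : 0 < δ := by positivity
  obtain ⟨N, -, hNfin, hNcov⟩ := Metric.finite_approx_of_totallyBounded htb δ hδ0
  refine ⟨(fun q : EuclideanSpace ℝ (Fin d) × EuclideanSpace ℝ (Fin d) =>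
      coneApexes Ω c r q.1 ∩ Metric.ball q.2 δ) '' (D ×ˢ N), (hDfin.prod hNfin).image _, ?_, ?_,
    4 / (1 - c) + 1, by positivity, ?_⟩
  · rintro _ ⟨q, -, rfl⟩ x hx
    exact hx.1.1
  · intro x hx
    obtain ⟨ξ, hξ, hxξ⟩ := hD x hx
    obtain ⟨y, hy, hxy⟩ := mem_iUnion₂.1 (hNcov hx)
    exact ⟨_, ⟨(ξ, y), ⟨hξ, hy⟩, rfl⟩, hxξ, hxy⟩
  · rintro _ ⟨⟨ξ, w⟩, ⟨hξ, -⟩, rfl⟩ G L hL hG x hx y hy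
    refine norm_sub_le_of_mem_coneApexes hL hc hG (hD1 ξ hξ) hx.1 hy.1 ?_
    have h1 : ‖x - y‖ ≤ δ + δ := by
      rw [← dist_eq_norm]
      exact (dist_triangle_right x y w).trans (add_le_add hx.2.le hy.2.le)
    calc (2 / (1 - c) + 1) * ‖x - y‖ ≤ (2 / (1 - c) + 1) * (δ + δ) := by gcongr
      _ = r := by rw [hδ]; field_simp; ring

end ConePieces

/-! ### Moments on the closed span of a Gaussian process -/

section GaussianMoments

/-- The absolute moments of the standard Gaussian distribution. -/
noncomputable def stdGaussianMoment (q : ℕ) : ℝ≥0∞ := ∫⁻ x, ‖x‖ₑ ^ q ∂(gaussianReal 0 1)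

theorem stdGaussianMoment_ne_top (q : ℕ) : stdGaussianMoment q ≠ ∞ := by
  rcases Nat.eq_zero_or_pos q with rfl | hq
  · simp [stdGaussianMoment]
  have h := (memLp_id_gaussianReal' (μ := 0) (v := 1) (q : ℝ≥0∞) (by simp)).2
  rw [eLpNorm_lt_top_iff_lintegral_rpow_enorm_lt_top (by simpa using hq.ne') (by simp)] at h
  simpa [stdGaussianMoment] using h.ne

variable {S : Type*} [MeasurableSpace S] {P : Measure S}

theorem eLpNorm_two_sq (X : S → ℝ) : eLpNorm X 2 P ^ 2 = ∫⁻ ω, ‖X ω‖ₑ ^ 2 ∂P := by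
  have := eLpNorm_nnreal_pow_eq_lintegral (μ := P) (f := X) (p := 2) (by simp)
  simpa using this

/-- `X` has the law of `σ` times a standard Gaussian variable, and the case `q = 2` identifies `σ`
with the L² norm of `X`. -/
theorem HasGaussianLaw.lintegral_enorm_pow {X : S → ℝ} (hX : HasGaussianLaw X P)
    (hmean : ∫ ω, X ω ∂P = 0) (q : ℕ) :
    ∫⁻ ω, ‖X ω‖ₑ ^ q ∂P = stdGaussianMoment q * eLpNorm X 2 P ^ q := by
  set σ : ℝ := √(Var[X; P]) with hσ
  have hlaw : P.map X = (gaussianReal 0 1).map (fun x => σ * x) := by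
    rw [hX.map_eq_gaussianReal, gaussianReal_map_const_mul, hmean]
    congr 1
    · simp
    · ext
      simp [hσ, Real.sq_sqrt (variance_nonneg X P), variance_nonneg X P]
  have h : ∀ q : ℕ, ∫⁻ ω, ‖X ω‖ₑ ^ q ∂P = ‖σ‖ₑ ^ q * stdGaussianMoment q := fun q => by
    rw [← lintegral_map' (f := fun x : ℝ => ‖x‖ₑ ^ q) (by fun_prop) hX.aemeasurable, hlaw,
      lintegral_map (by fun_prop) (by fun_prop)]
    simp_rw [enorm_mul, mul_pow]
    rw [lintegral_const_mul _ (by fun_prop), stdGaussianMoment]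
  have hstd : stdGaussianMoment 2 = 1 := by
    have h1 : ∫ x, x ^ 2 ∂(gaussianReal 0 1) = 1 := by
      have := variance_of_integral_eq_zero (X := fun x : ℝ => x) (μ := gaussianReal 0 1)
        (by fun_prop) (by simp)
      rw [← this]
      simp
    have h2 : Integrable (fun x : ℝ => x ^ 2) (gaussianReal 0 1) :=
      (memLp_id_gaussianReal (μ := 0) (v := 1) 2).integrable_sq
    rw [stdGaussianMoment, ← ENNReal.ofReal_one, ← h1,
      ofReal_integral_eq_lintegral_ofReal h2 (Eventually.of_forall fun x => sq_nonneg x)]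
    refine lintegral_congr fun x => ?_
    rw [← enorm_pow, Real.enorm_of_nonneg (sq_nonneg x)]
  have h2 : eLpNorm X 2 P = ‖σ‖ₑ := by
    have h3 : eLpNorm X 2 P ^ 2 = ‖σ‖ₑ ^ 2 := by rw [eLpNorm_two_sq, h 2, hstd, mul_one]
    exact (ENNReal.pow_right_strictMono two_ne_zero).injective h3
  rw [h q, h2, mul_comm]

/-- Fatou's lemma along an almost everywhere convergent subsequence. This carries the moment bound
from the span to its closure without identifying the law of the limit. -/
theorem isClosed_setOf_lintegral_enorm_pow_le (c : ℝ≥0∞) (hc : c ≠ ∞) (q : ℕ) :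
    IsClosed {f : Lp ℝ 2 P | ∫⁻ ω, ‖f ω‖ₑ ^ q ∂P ≤ c * ‖f‖ₑ ^ q} := by
  refine IsSeqClosed.isClosed fun f f₀ hf hlim => ?_
  obtain ⟨ns, hns, hae⟩ := (tendstoInMeasure_of_tendsto_Lp hlim).exists_seq_tendsto_ae
  have hlim' : Tendsto (fun i => c * ‖f (ns i)‖ₑ ^ q) atTop (𝓝 (c * ‖f₀‖ₑ ^ q)) := by
    refine ENNReal.Tendsto.const_mul ?_ (Or.inr hc)
    exact (ENNReal.continuous_pow q).tendsto _ |>.comp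
      (((continuous_enorm).tendsto _).comp (hlim.comp hns.tendsto_atTop))
  calc ∫⁻ ω, ‖f₀ ω‖ₑ ^ q ∂P = ∫⁻ ω, liminf (fun i => ‖f (ns i) ω‖ₑ ^ q) atTop ∂P := by
        refine lintegral_congr_ae ?_
        filter_upwards [hae] with ω hω
        exact (((ENNReal.continuous_pow q).tendsto _).comp
          ((continuous_enorm.tendsto _).comp hω)).liminf_eq.symm
    _ ≤ liminf (fun i => ∫⁻ ω, ‖f (ns i) ω‖ₑ ^ q ∂P) atTop :=
        lintegral_liminf_le' fun i => (Lp.aestronglyMeasurable _).enorm.pow_const q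
    _ ≤ liminf (fun i => c * ‖f (ns i)‖ₑ ^ q) atTop :=
        liminf_le_liminf (Eventually.of_forall fun i => hf (ns i))
    _ = c * ‖f₀‖ₑ ^ q := hlim'.liminf_eq

/-- Moments of the elements of the closed linear span of a centered Gaussian process. -/
theorem IsGaussianProcess.lintegral_enorm_pow_le {T : Type*} {X : T → S → ℝ}
    (hX : IsGaussianProcess X P) (hmean : ∀ t, ∫ ω, X t ω ∂P = 0) {Y : T → Lp ℝ 2 P}
    (hY : ∀ t, Y t =ᵐ[P] X t) {f : Lp ℝ 2 P}
    (hf : f ∈ (Submodule.span ℝ (range Y)).topologicalClosure) (q : ℕ) :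
    ∫⁻ ω, ‖f ω‖ₑ ^ q ∂P ≤ stdGaussianMoment q * ‖f‖ₑ ^ q := by
  refine closure_minimal (t := {f : Lp ℝ 2 P | ∫⁻ ω, ‖f ω‖ₑ ^ q ∂P ≤
    stdGaussianMoment q * ‖f‖ₑ ^ q}) (fun x hx => ?_)
    (isClosed_setOf_lintegral_enorm_pow_le _ (stdGaussianMoment_ne_top q) q) hf
  obtain ⟨c, rfl⟩ := Finsupp.mem_span_range_iff_exists_finsupp.1 hx
  have hae : (c.sum fun i a => a • Y i : Lp ℝ 2 P) =ᵐ[P]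
      fun ω => ∑ i ∈ c.support, c i • X i ω := by
    rw [Finsupp.sum]
    refine (Lp.coeFn_finsetSum _ _).trans ?_
    have : ∀ᵐ ω ∂P, ∀ i ∈ c.support, (c i • Y i : Lp ℝ 2 P) ω = c i • X i ω := by
      rw [Finset.eventually_all]
      intro i _
      filter_upwards [Lp.coeFn_smul (c i) (Y i), hY i] with ω h1 h2
      rw [h1, Pi.smul_apply, h2]
    filter_upwards [this] with ω hω
    rw [Finset.sum_apply]
    exact Finset.sum_congr rfl hω
  have hgauss : HasGaussianLaw (fun ω => ∑ i ∈ c.support, c i • X i ω) P :=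
    (hX.smul c).hasGaussianLaw_fun_sum
  have hzero : ∫ ω, ∑ i ∈ c.support, c i • X i ω ∂P = 0 := by
    have hint : ∀ i ∈ c.support, Integrable (fun ω => c i • X i ω) P := fun i _ =>
      ((hX.hasGaussianLaw_eval i).integrable).smul (c i)
    rw [integral_finsetSum _ hint]
    simp [integral_const_mul, hmean]
  have h1 := HasGaussianLaw.lintegral_enorm_pow hgauss hzero q
  rw [mem_ofPred_eq]
  refine le_of_eq ?_
  rw [Lp.enorm_def, eLpNorm_congr_ae hae, ← h1]
  exact lintegral_congr_ae (by filter_upwards [hae] with ω hω; rw [hω])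

end GaussianMoments

/-! ### Kolmogorov's criterion by chaining over dyadic nets -/

section Chaining

/-- A bounded set in `ℝᵈ` has `2⁻ⁿ`-nets of cardinality `O(2ⁿᵈ)`. -/
theorem exists_dyadic_nets {d : ℕ} {A : Set (EuclideanSpace ℝ (Fin d))}
    (hA : Bornology.IsBounded A) : ∃ K : ℕ, ∀ n : ℕ,
      ∃ (N : Finset (EuclideanSpace ℝ (Fin d)))
        (π : EuclideanSpace ℝ (Fin d) → EuclideanSpace ℝ (Fin d)),
        (N : Set (EuclideanSpace ℝ (Fin d))) ⊆ A ∧ N.card ≤ K * 2 ^ (n * d) ∧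
          ∀ x ∈ A, π x ∈ N ∧ dist (π x) x ≤ (1 / 2) ^ n := by
  classical
  rcases A.eq_empty_or_nonempty with rfl | ⟨x₀, hx₀⟩
  · exact ⟨0, fun n => ⟨∅, id, by simp, by simp, by simp⟩⟩
  obtain ⟨R, hR⟩ := hA.exists_norm_le
  set M : ℕ := ⌈(d + 1) * R⌉₊ + 1 with hM
  refine ⟨(2 * M + 1) ^ d, fun n => ?_⟩
  -- Cells have side `2⁻ⁿ / (d + 1)`, so summing over coordinates bounds their diameter by `2⁻ⁿ`.
  -- Representatives are taken in `A` itself, where the process is controlled.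
  set cell : EuclideanSpace ℝ (Fin d) → Fin d → ℤ := fun x i => ⌊2 ^ n * (d + 1) * x i⌋ with hcell
  set rep : (Fin d → ℤ) → EuclideanSpace ℝ (Fin d) := fun c =>
    if h : ∃ x ∈ A, cell x = c then h.choose else x₀ with hrep
  have hrepA : ∀ c, rep c ∈ A := fun c => by
    simp only [hrep]
    split_ifs with h
    · exact h.choose_spec.1
    · exact hx₀
  have hrepc : ∀ x ∈ A, cell (rep (cell x)) = cell x := fun x hx => by
    have h : ∃ y ∈ A, cell y = cell x := ⟨x, hx, rfl⟩
    simp only [hrep, dif_pos h]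
    exact h.choose_spec.2
  refine ⟨(Fintype.piFinset fun _ : Fin d =>
    Finset.Icc (-(2 ^ n * M : ℤ)) (2 ^ n * M)).image rep, fun x => rep (cell x), ?_, ?_, ?_⟩
  · intro x hx
    obtain ⟨c, -, rfl⟩ := Finset.mem_image.1 (Finset.mem_coe.1 hx)
    exact hrepA c
  · refine Finset.card_image_le.trans ?_
    rw [Fintype.card_piFinset_const, Int.card_Icc, pow_mul, ← mul_pow]
    refine Nat.pow_le_pow_left ?_ d
    have h1 : (1 : ℤ) ≤ 2 ^ n := one_le_pow₀ (by norm_num)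
    rw [Int.toNat_le]
    push_cast
    nlinarith
  · intro x hx
    constructor
    · refine Finset.mem_image_of_mem _ (Fintype.mem_piFinset.2 fun i => ?_)
      have h1 : |x i| ≤ R := (EuclideanSpace.abs_apply_le_norm x i).trans (hR x hx)
      have h2 : (d + 1) * R ≤ ⌈(d + 1) * R⌉₊ := Nat.le_ceil _
      have h3 : |2 ^ n * (d + 1) * x i| ≤ 2 ^ n * (M - 1 : ℝ) := by
        rw [abs_mul, abs_of_nonneg (by positivity : (0 : ℝ) ≤ 2 ^ n * (d + 1)), mul_assoc]
        refine mul_le_mul_of_nonneg_left ?_ (by positivity)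
        rw [hM]
        push_cast
        calc _ ≤ (d + 1 : ℝ) * R := by gcongr
          _ ≤ _ := by linarith
      have h4 : (1 : ℝ) ≤ 2 ^ n := one_le_pow₀ (by norm_num)
      obtain ⟨h5, h6⟩ := abs_le.1 h3
      rw [Finset.mem_Icc]
      constructor
      · refine Int.le_floor.2 ?_
        push_cast
        linarith
      · refine Int.floor_le_iff.2 ?_
        push_cast
        linarith
    · have hcoord : ∀ i, |(rep (cell x) - x) i| ≤ (1 / 2) ^ n / (d + 1) := fun i => by
        have h1 : ⌊2 ^ n * (d + 1) * (rep (cell x)) i⌋ = ⌊2 ^ n * (d + 1) * x i⌋ :=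
          congrFun (hrepc x hx) i
        have h2 := Int.abs_sub_lt_one_of_floor_eq_floor h1
        rw [← mul_sub, abs_mul, abs_of_nonneg (by positivity : (0 : ℝ) ≤ 2 ^ n * (d + 1))] at h2
        rw [PiLp.sub_apply, one_div, inv_pow, ← one_div, div_div, le_div_iff₀ (by positivity)]
        linarith
      rw [dist_eq_norm]
      have hsum : rep (cell x) - x =
          ∑ b, (rep (cell x) - x) b • EuclideanSpace.single b (1 : ℝ) := by
        ext i
        simp [Finset.sum_apply, Pi.single_apply]
      rw [hsum]
      calc _ ≤ ∑ _b : Fin d, ((1 / 2 : ℝ) ^ n / (d + 1)) := by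
            refine (norm_sum_le _ _).trans (Finset.sum_le_sum fun b _ => ?_)
            rw [norm_smul, PiLp.norm_single, norm_one, mul_one, Real.norm_eq_abs]
            exact hcoord b
        _ = (1 / 2 : ℝ) ^ n * (d / (d + 1)) := by simp; ring
        _ ≤ (1 / 2 : ℝ) ^ n * 1 := by
            gcongr
            rw [div_le_one (by positivity)]
            linarith
        _ = _ := mul_one _

/-- Telescoping the links bounds `|f (π n x) - f x|` by a geometric tail; nearby points are then
compared through their approximations at level `n`. -/
theorem uniformContinuousOn_of_chaining {X : Type*} [PseudoMetricSpace X] {T : Set X} {f : X → ℝ}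
    {π : ℕ → X → X} {B ρ : ℝ} (hρ0 : 0 ≤ ρ) (hρ1 : ρ < 1)
    (h1 : ∀ n, ∀ x ∈ T, |f (π n x) - f (π (n + 1) x)| ≤ B * ρ ^ n)
    (h2 : ∀ n, ∀ x ∈ T, ∀ y ∈ T, dist x y ≤ (1 / 2) ^ n → |f (π n x) - f (π n y)| ≤ B * ρ ^ n)
    (h3 : ∀ x ∈ T, Tendsto (fun n => f (π n x)) atTop (𝓝 (f x))) : UniformContinuousOn f T := by
  have happrox : ∀ n, ∀ x ∈ T, dist (f (π n x)) (f x) ≤ B * ρ ^ n / (1 - ρ) := fun n x hx =>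
    dist_le_of_le_geometric_of_tendsto ρ B hρ1 (fun n => h1 n x hx) (h3 x hx) n
  rw [Metric.uniformContinuousOn_iff]
  intro ε hε
  have hlim : Tendsto (fun n : ℕ => B * ρ ^ n / (1 - ρ) + B * ρ ^ n + B * ρ ^ n / (1 - ρ)) atTop
      (𝓝 0) := by
    have h0 := (tendsto_pow_atTop_nhds_zero_of_lt_one hρ0 hρ1).const_mul B
    simpa using ((h0.div_const (1 - ρ)).add h0).add (h0.div_const (1 - ρ))
  obtain ⟨n, hn⟩ := (hlim.eventually_lt_const hε).exists
  refine ⟨(1 / 2) ^ n, by positivity, fun x hx y hy hxy => lt_of_le_of_lt ?_ hn⟩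
  refine (dist_triangle4 (f x) (f (π n x)) (f (π n y)) (f y)).trans ?_
  refine add_le_add (add_le_add ?_ (h2 n x hx y hy hxy.le)) (happrox n y hy)
  rw [dist_comm]
  exact happrox n x hx

variable {S : Type*} [MeasurableSpace S] {P : Measure S}

theorem ae_exists_bound_of_tsum_lintegral_ne_top {Z : ℕ → S → ℝ≥0∞}
    (hZ : ∀ n, AEMeasurable (Z n) P) (h : ∑' n, ∫⁻ ω, Z n ω ∂P ≠ ∞) :
    ∀ᵐ ω ∂P, ∑' n, Z n ω ≠ ∞ := by
  rw [← lintegral_tsum hZ] at h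
  filter_upwards [ae_lt_top' (AEMeasurable.tsum hZ) h] with ω hω using hω.ne

/-- Kolmogorov's continuity criterion, on a countable subset of a bounded set. -/
theorem ae_uniformContinuousOn_of_moment {d : ℕ} {A : Set (EuclideanSpace ℝ (Fin d))}
    (hA : Bornology.IsBounded A) {h : EuclideanSpace ℝ (Fin d) → S → ℝ}
    (hmeas : ∀ x ∈ A, AEMeasurable (h x) P) {q : ℕ} (hq : q ≠ 0) {C : ℝ≥0∞} (hC : C ≠ ∞)
    (hmom : ∀ x ∈ A, ∀ y ∈ A,
      ∫⁻ ω, ‖h x ω - h y ω‖ₑ ^ q ∂P ≤ C * edist x y ^ (2 * d + 2))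
    {T : Set (EuclideanSpace ℝ (Fin d))} (hT : T.Countable) (hTA : T ⊆ A) :
    ∀ᵐ ω ∂P, UniformContinuousOn (fun x => h x ω) T := by
  classical
  obtain ⟨K, hK⟩ := exists_dyadic_nets hA
  choose N π hNA hNcard hπ using hK
  have hdist : ∀ n, ∀ x ∈ A, edist (π n x) x ≤ 2⁻¹ ^ n := fun n x hx => by
    have := (hπ n x hx).2
    rw [edist_dist]
    refine (ENNReal.ofReal_le_ofReal this).trans (le_of_eq ?_)
    rw [ENNReal.ofReal_pow (by norm_num), one_div, ENNReal.ofReal_inv_of_pos (by norm_num)]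
    simp
  -- `D n` holds both kinds of pair used in chaining: links between levels `n` and `n + 1`, and
  -- approximations at level `n` of two points within `2⁻ⁿ`. Both are at most `3 * 2⁻ⁿ` apart.
  set D : ℕ → Finset (EuclideanSpace ℝ (Fin d) × EuclideanSpace ℝ (Fin d)) := fun n =>
    ((N n ∪ N (n + 1)) ×ˢ (N n ∪ N (n + 1))).filter
      fun z => edist z.1 z.2 ≤ 3 * 2⁻¹ ^ n with hD
  have hDA : ∀ n, ∀ z ∈ D n, z.1 ∈ A ∧ z.2 ∈ A ∧ edist z.1 z.2 ≤ 3 * 2⁻¹ ^ n := by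
    intro n z hz
    obtain ⟨hz1, hz2⟩ := Finset.mem_filter.1 hz
    obtain ⟨hz3, hz4⟩ := Finset.mem_product.1 hz1
    refine ⟨?_, ?_, hz2⟩
    · rcases Finset.mem_union.1 hz3 with h | h <;> exact hNA _ h
    · rcases Finset.mem_union.1 hz4 with h | h <;> exact hNA _ h
  have hDcard : ∀ n, (D n).card ≤ (K * (1 + 2 ^ d)) ^ 2 * 2 ^ (n * (2 * d)) := fun n => by
    have h1 : (N n ∪ N (n + 1)).card ≤ K * (1 + 2 ^ d) * 2 ^ (n * d) := by
      refine (Finset.card_union_le _ _).trans ((add_le_add (hNcard n) (hNcard (n + 1))).trans ?_)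
      refine le_of_eq ?_
      ring
    refine (Finset.card_filter_le _ _).trans ?_
    rw [Finset.card_product, ← sq]
    refine (Nat.pow_le_pow_left h1 2).trans (le_of_eq ?_)
    ring
  have hincr : ∀ x ∈ A, ∀ y ∈ A, AEMeasurable (fun ω => ‖h x ω - h y ω‖ₑ ^ q) P :=
    fun x hx y hy => ((hmeas x hx).sub (hmeas y hy)).enorm.pow_const q
  -- There are `O(2^(2nd))` pairs, each with moment `O(2^(-n(2d+2)))`. With the weight `2 ^ n` the
  -- expectations are still `O(2⁻ⁿ)`, and finiteness of the sum makes increments at level `n` decay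
  -- like `2^(-n/q)`.
  set Z : ℕ → S → ℝ≥0∞ := fun n ω => 2 ^ n * ∑ z ∈ D n, ‖h z.1 ω - h z.2 ω‖ₑ ^ q with hZ
  have hZmeas : ∀ n, AEMeasurable (Z n) P := fun n =>
    (Finset.aemeasurable_fun_sum _ fun z hz => hincr _ (hDA n z hz).1 _ (hDA n z hz).2.1).const_mul _
  have hZint : ∀ n, ∫⁻ ω, Z n ω ∂P ≤
      ((K * (1 + 2 ^ d)) ^ 2 * (C * 3 ^ (2 * d + 2))) * 2⁻¹ ^ n := fun n => by
    rw [hZ]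
    dsimp only
    rw [lintegral_const_mul'' _ (Finset.aemeasurable_fun_sum _ fun z hz =>
        hincr _ (hDA n z hz).1 _ (hDA n z hz).2.1),
      lintegral_finsetSum' _ fun z hz => hincr _ (hDA n z hz).1 _ (hDA n z hz).2.1]
    have h2 : ∀ z ∈ D n, ∫⁻ ω, ‖h z.1 ω - h z.2 ω‖ₑ ^ q ∂P ≤
        C * (3 * 2⁻¹ ^ n) ^ (2 * d + 2) := fun z hz => by
      obtain ⟨hz1, hz2, hz3⟩ := hDA n z hz
      refine (hmom _ hz1 _ hz2).trans ?_
      gcongr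
    have hcancel : ∀ m : ℕ, (2 : ℝ≥0∞) ^ m * 2⁻¹ ^ m = 1 := fun m => by
      rw [← mul_pow, ENNReal.mul_inv_cancel (by simp) (by simp), one_pow]
    calc 2 ^ n * ∑ z ∈ D n, ∫⁻ ω, ‖h z.1 ω - h z.2 ω‖ₑ ^ q ∂P
        ≤ 2 ^ n * ∑ _z ∈ D n, C * (3 * 2⁻¹ ^ n) ^ (2 * d + 2) := by
          gcongr with z hz
          exact h2 z hz
      _ = 2 ^ n * ((D n).card * (C * (3 * 2⁻¹ ^ n) ^ (2 * d + 2))) := by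
          rw [Finset.sum_const, nsmul_eq_mul]
      _ ≤ 2 ^ n * (((K * (1 + 2 ^ d)) ^ 2 * 2 ^ (n * (2 * d)) : ℕ) *
            (C * (3 * 2⁻¹ ^ n) ^ (2 * d + 2))) := by
          gcongr
          exact hDcard n
      _ = ((K * (1 + 2 ^ d)) ^ 2 * (C * 3 ^ (2 * d + 2))) * 2⁻¹ ^ n *
            (2 ^ n * 2⁻¹ ^ n) * (2 ^ (n * (2 * d)) * 2⁻¹ ^ (n * (2 * d))) := by
          push_cast
          ring
      _ = _ := by rw [hcancel, hcancel, mul_one, mul_one]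
  have hgeom : ∀ c : ℝ≥0∞, c ≠ ∞ → ∑' n : ℕ, c * 2⁻¹ ^ n ≠ ∞ := fun c hc => by
    rw [ENNReal.tsum_mul_left, ENNReal.tsum_geometric]
    refine ENNReal.mul_ne_top hc ?_
    rw [ENNReal.one_sub_inv_two, inv_inv]
    simp
  have hae1 := ae_exists_bound_of_tsum_lintegral_ne_top hZmeas
    (ne_top_of_le_ne_top (hgeom _ (by finiteness)) (ENNReal.tsum_le_tsum hZint))
  have hae2 : ∀ᵐ ω ∂P, ∀ x ∈ T, Tendsto (fun n => h (π n x) ω) atTop (𝓝 (h x ω)) := by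
    refine (ae_ball_iff hT).2 fun x hx => ?_
    have hxA := hTA hx
    have hb : ∀ n, ∫⁻ ω, ‖h (π n x) ω - h x ω‖ₑ ^ q ∂P ≤ C * 2⁻¹ ^ n := fun n => by
      have hpow : edist (π n x) x ^ (2 * d + 2) ≤ 2⁻¹ ^ n := by
        refine (pow_le_pow_left' (hdist n x hxA) _).trans ?_
        rw [← pow_mul]
        exact pow_le_pow_right_of_le_one' (by simp) (Nat.le_mul_of_pos_right _ (by omega))
      exact (hmom _ (hNA n (hπ n x hxA).1) _ hxA).trans (by gcongr)
    have := ae_exists_bound_of_tsum_lintegral_ne_top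
      (fun n => hincr _ (hNA n (hπ n x hxA).1) _ hxA)
      (ne_top_of_le_ne_top (hgeom _ hC) (ENNReal.tsum_le_tsum hb))
    filter_upwards [this] with ω hω
    have h1 := ENNReal.tendsto_atTop_zero_of_tsum_ne_top hω
    have h2 := (ENNReal.continuous_rpow_const (y := (q : ℝ)⁻¹)).tendsto 0 |>.comp h1
    rw [ENNReal.zero_rpow_of_pos (by positivity)] at h2
    rw [tendsto_iff_edist_tendsto_0]
    refine h2.congr fun n => ?_
    simp only [Function.comp]
    rw [← ENNReal.rpow_natCast, ENNReal.rpow_rpow_inv (by exact_mod_cast hq), edist_eq_enorm_sub]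
  filter_upwards [hae1, hae2] with ω h1 h2
  set b : ℝ≥0∞ := ∑' n, Z n ω with hb
  have hq' : (0 : ℝ) < (q : ℝ)⁻¹ := by positivity
  set B : ℝ := (b ^ ((q : ℝ)⁻¹)).toReal with hB
  set ρ : ℝ := ((2⁻¹ : ℝ≥0∞) ^ ((q : ℝ)⁻¹)).toReal with hρ
  have hρlt : (2⁻¹ : ℝ≥0∞) ^ ((q : ℝ)⁻¹) < 1 := ENNReal.rpow_lt_one (by simp) hq'
  have hbound : ∀ n, ∀ z ∈ D n, |h z.1 ω - h z.2 ω| ≤ B * ρ ^ n := by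
    intro n z hz
    have h3 : 2 ^ n * ‖h z.1 ω - h z.2 ω‖ₑ ^ q ≤ b := by
      refine le_trans ?_ (ENNReal.le_tsum n)
      rw [hZ]
      dsimp only
      gcongr
      exact Finset.single_le_sum (f := fun z => ‖h z.1 ω - h z.2 ω‖ₑ ^ q)
        (fun _ _ => zero_le) hz
    have h4 : ‖h z.1 ω - h z.2 ω‖ₑ ^ q ≤ b * 2⁻¹ ^ n := by
      calc _ = 2⁻¹ ^ n * (2 ^ n * ‖h z.1 ω - h z.2 ω‖ₑ ^ q) := by
            rw [← mul_assoc, ← mul_pow, ENNReal.inv_mul_cancel (by simp) (by simp), one_pow,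
              one_mul]
        _ ≤ 2⁻¹ ^ n * b := by gcongr
        _ = _ := mul_comm _ _
    have h5 : ‖h z.1 ω - h z.2 ω‖ₑ ≤ b ^ ((q : ℝ)⁻¹) * (2⁻¹ ^ ((q : ℝ)⁻¹)) ^ n := by
      have := ENNReal.rpow_le_rpow h4 hq'.le
      rw [← ENNReal.rpow_natCast, ENNReal.rpow_rpow_inv (by exact_mod_cast hq),
        ENNReal.mul_rpow_of_nonneg _ _ hq'.le] at this
      refine this.trans (le_of_eq ?_)
      congr 1
      rw [← ENNReal.rpow_natCast, ← ENNReal.rpow_natCast, ← ENNReal.rpow_mul,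
        ← ENNReal.rpow_mul, mul_comm]
    have h6 := ENNReal.toReal_mono (ENNReal.mul_ne_top (ENNReal.rpow_ne_top_of_nonneg hq'.le h1)
      (ENNReal.pow_ne_top hρlt.ne_top)) h5
    rwa [ENNReal.toReal_mul, ENNReal.toReal_pow, toReal_enorm, Real.norm_eq_abs] at h6
  refine uniformContinuousOn_of_chaining (π := π) (B := B) (ρ := ρ) ENNReal.toReal_nonneg
    ?_ ?_ ?_ h2
  · rw [hρ, ← ENNReal.toReal_one]
    exact (ENNReal.toReal_lt_toReal hρlt.ne_top (by simp)).2 hρlt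
  · intro n x hx
    refine hbound n (π n x, π (n + 1) x) (Finset.mem_filter.2 ⟨Finset.mem_product.2
      ⟨Finset.mem_union_left _ (hπ n x (hTA hx)).1,
        Finset.mem_union_right _ (hπ (n + 1) x (hTA hx)).1⟩, ?_⟩)
    refine (edist_triangle_right _ _ x).trans ?_
    calc _ ≤ (2⁻¹ : ℝ≥0∞) ^ n + 2⁻¹ ^ n := add_le_add (hdist n x (hTA hx))
          ((hdist (n + 1) x (hTA hx)).trans (pow_le_pow_right_of_le_one' (by simp) n.le_succ))
      _ ≤ (2⁻¹ : ℝ≥0∞) ^ n + 2⁻¹ ^ n + 2⁻¹ ^ n := le_self_add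
      _ = 3 * 2⁻¹ ^ n := by ring
  · intro n x hx y hy hxy
    refine hbound n (π n x, π n y) (Finset.mem_filter.2 ⟨Finset.mem_product.2
      ⟨Finset.mem_union_left _ (hπ n x (hTA hx)).1,
        Finset.mem_union_left _ (hπ n y (hTA hy)).1⟩, ?_⟩)
    have hxy' : edist x y ≤ 2⁻¹ ^ n := by
      rw [edist_dist]
      refine (ENNReal.ofReal_le_ofReal hxy).trans (le_of_eq ?_)
      rw [ENNReal.ofReal_pow (by norm_num), one_div, ENNReal.ofReal_inv_of_pos (by norm_num)]
      simp
    calc edist (π n x) (π n y) ≤ edist (π n x) x + edist x y + edist y (π n y) :=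
          edist_triangle4 _ _ _ _
      _ ≤ 2⁻¹ ^ n + 2⁻¹ ^ n + 2⁻¹ ^ n := by
          gcongr
          · exact hdist n x (hTA hx)
          · rw [edist_comm]; exact hdist n y (hTA hy)
      _ = 3 * 2⁻¹ ^ n := by ring

end Chaining

/-! ### A countable dense set stable under rational coordinate steps -/

section RationalPoints

/-- The points of `ℝᵈ` with rational coordinates. -/
def rationalPoints (d : ℕ) : Set (EuclideanSpace ℝ (Fin d)) :=
  range fun r : Fin d → ℚ => WithLp.toLp 2 fun i => (r i : ℝ)

theorem rationalPoints_countable (d : ℕ) : (rationalPoints d).Countable := countable_range _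

theorem dense_rationalPoints (d : ℕ) : Dense (rationalPoints d) := by
  have h1 : DenseRange (Pi.map fun (_ : Fin d) (r : ℚ) => (r : ℝ)) :=
    DenseRange.piMap fun _ => Rat.denseRange_cast
  have h2 : DenseRange (WithLp.toLp 2 : (Fin d → ℝ) → EuclideanSpace ℝ (Fin d)) :=
    Function.Surjective.denseRange fun x => ⟨x.ofLp, rfl⟩
  exact h2.comp h1 (PiLp.continuous_toLp 2 _)

theorem add_smul_single_mem_rationalPoints {d : ℕ} {x : EuclideanSpace ℝ (Fin d)}
    (hx : x ∈ rationalPoints d) (t : ℚ) (a : Fin d) :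
    x + (t : ℝ) • EuclideanSpace.single a (1 : ℝ) ∈ rationalPoints d := by
  obtain ⟨r, rfl⟩ := hx
  refine ⟨r + Pi.single a t, ?_⟩
  ext i
  by_cases h : i = a
  · subst h
    simp
  · simp [h]

end RationalPoints

/-! ### Differentiability of paths from increments at rational points -/

section Paths

/-- A function that satisfies a mean value inequality at rational points is differentiable. -/
theorem hasLineDerivAt_of_rational_increments {d : ℕ} {Ω : Set (EuclideanSpace ℝ (Fin d))}
    (hΩ : IsOpen Ω) {f f' : EuclideanSpace ℝ (Fin d) → ℝ} (hf : ContinuousOn f Ω)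
    (hf' : ContinuousOn f' Ω) {a : Fin d}
    (h : ∀ x ∈ rationalPoints d, ∀ t : ℚ,
      (∀ s ∈ Icc (0 : ℝ) 1, x + (s * t) • EuclideanSpace.single a (1 : ℝ) ∈ Ω) →
      ∀ c ε : ℝ, (∀ s : ℚ, (s : ℝ) ∈ Icc (0 : ℝ) 1 →
        |f' (x + ((s : ℝ) * t) • EuclideanSpace.single a (1 : ℝ)) - c| ≤ ε) →
      |f (x + (t : ℝ) • EuclideanSpace.single a (1 : ℝ)) - f x - t * c| ≤ |(t : ℝ)| * ε)
    {u : EuclideanSpace ℝ (Fin d)} (hu : u ∈ Ω) :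
    HasLineDerivAt ℝ f (f' u) u (EuclideanSpace.single a (1 : ℝ)) := by
  set e : EuclideanSpace ℝ (Fin d) := EuclideanSpace.single a (1 : ℝ) with he
  have hnorm : ‖e‖ = 1 := by rw [he, PiLp.norm_single, norm_one]
  rw [hasLineDerivAt_iff_isLittleO_nhds_zero, Asymptotics.isLittleO_iff]
  intro η hη
  have hnhds : Ω ∩ {y | |f' y - f' u| ≤ η} ∈ 𝓝 u := by
    refine inter_mem (hΩ.mem_nhds hu) ?_
    have := (hf'.continuousAt (hΩ.mem_nhds hu)).tendsto
    filter_upwards [Metric.tendsto_nhds.1 this η hη] with y hy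
    exact (Real.dist_eq _ _ ▸ hy).le
  obtain ⟨δ, hδ, hball⟩ := Metric.mem_nhds_iff.1 hnhds
  have hline : ∀ x ∈ Metric.ball u (δ / 2), ∀ t ∈ Metric.ball (0 : ℝ) (δ / 2),
      ∀ s ∈ Icc (0 : ℝ) 1, x + (s * t) • e ∈ Metric.ball u δ := by
    intro x hx t ht s hs
    rw [Metric.mem_ball, Real.dist_0_eq_abs] at ht
    rw [Metric.mem_ball] at hx ⊢
    have h1 : dist (x + (s * t) • e) x ≤ |t| := by
      rw [dist_eq_norm, add_sub_cancel_left, norm_smul, hnorm, mul_one, norm_mul,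
        Real.norm_of_nonneg hs.1, Real.norm_eq_abs]
      exact mul_le_of_le_one_left (abs_nonneg _) hs.2
    linarith [dist_triangle (x + (s * t) • e) x u]
  set W : Set (EuclideanSpace ℝ (Fin d) × ℝ) :=
    Metric.ball u (δ / 2) ×ˢ Metric.ball (0 : ℝ) (δ / 2) with hW
  have hWo : IsOpen W := Metric.isOpen_ball.prod Metric.isOpen_ball
  set Φ : EuclideanSpace ℝ (Fin d) × ℝ → ℝ := fun z =>
    |f (z.1 + z.2 • e) - f z.1 - z.2 * f' u| - |z.2| * η with hΦ
  have hΦc : ContinuousOn Φ W := by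
    have h1 : ContinuousOn (fun z : EuclideanSpace ℝ (Fin d) × ℝ => f (z.1 + z.2 • e)) W := by
      refine hf.comp (by fun_prop) fun z hz => ?_
      have := (hball (hline z.1 hz.1 z.2 hz.2 1 (by simp))).1
      simpa using this
    have h2 : ContinuousOn (fun z : EuclideanSpace ℝ (Fin d) × ℝ => f z.1) W := by
      refine hf.comp (by fun_prop) fun z hz => ?_
      have := (hball (hline z.1 hz.1 z.2 hz.2 0 (by simp))).1
      simpa using this
    exact ((h1.sub h2).sub (continuous_snd.continuousOn.mul continuousOn_const)).abs.sub
      (continuous_snd.abs.mul continuous_const).continuousOn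
  -- A positive value of the continuous `Φ` would persist on an open set, hence at a rational base
  -- point and step, against `h` with `c = f' u` and `ε = η`. The base point `u` itself may be
  -- irrational.
  have hΦle : ∀ z ∈ W, Φ z ≤ 0 := by
    by_contra! hcon
    obtain ⟨z, hz, hpos⟩ := hcon
    have hopen := hΦc.isOpen_inter_preimage hWo (isOpen_Ioi (a := (0 : ℝ)))
    have hdense : Dense (rationalPoints d ×ˢ range ((↑) : ℚ → ℝ)) :=
      (dense_rationalPoints d).prod Rat.denseRange_cast
    obtain ⟨⟨x, t⟩, ⟨hxW, hxpos⟩, hx, ⟨t, rfl⟩⟩ := hdense.inter_open_nonempty _ hopen ⟨z, hz, hpos⟩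
    have := h x hx t (fun s hs => (hball (hline x hxW.1 t hxW.2 s hs)).1) (f' u) η
      (fun s hs => (hball (hline x hxW.1 t hxW.2 s hs)).2)
    simp only [hΦ, mem_preimage, mem_Ioi] at hxpos
    linarith
  filter_upwards [Metric.ball_mem_nhds (0 : ℝ) (half_pos hδ)] with t ht
  have := hΦle (u, t) ⟨Metric.mem_ball_self (half_pos hδ), ht⟩
  simp only [hΦ] at this
  rw [Real.norm_eq_abs, Real.norm_eq_abs, smul_eq_mul]
  linarith

/-- Left Riemann sums of a continuous derivative converge to the increment. -/
theorem tendsto_riemann_sum {F : Type*} [NormedAddCommGroup F] [NormedSpace ℝ F] {φ φ' : ℝ → F}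
    (h : ∀ s ∈ Icc (0 : ℝ) 1, HasDerivAt φ (φ' s) s) (hc : ContinuousOn φ' (Icc 0 1)) :
    Tendsto (fun N : ℕ => (N : ℝ)⁻¹ • ∑ j ∈ Finset.range N, φ' (j / N)) atTop
      (𝓝 (φ 1 - φ 0)) := by
  rw [Metric.tendsto_atTop]
  intro ε hε
  obtain ⟨δ, hδ, hu⟩ := Metric.uniformContinuousOn_iff.1
    (isCompact_Icc.uniformContinuousOn_of_continuous hc) (ε / 2) (half_pos hε)
  obtain ⟨N₀, hN₀⟩ := exists_nat_gt δ⁻¹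
  refine ⟨N₀, fun N hN => ?_⟩
  have hNpos : (0 : ℝ) < N := (inv_pos.2 hδ).trans (hN₀.trans_le (by exact_mod_cast hN))
  have hNδ : (N : ℝ)⁻¹ < δ :=
    inv_lt_of_inv_lt₀ hδ (hN₀.trans_le (by exact_mod_cast hN))
  have hstep : ∀ j ∈ Finset.range N,
      ‖(N : ℝ)⁻¹ • φ' (j / N) - (φ ((j + 1 : ℕ) / N) - φ (j / N))‖ ≤ (ε / 2) * (N : ℝ)⁻¹ := by
    intro j hj
    have hj' : (j : ℝ) + 1 ≤ N := by exact_mod_cast Finset.mem_range.1 hj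
    have hsub : Icc ((j : ℝ) / N) ((j + 1 : ℕ) / N) ⊆ Icc 0 1 := by
      refine Icc_subset_Icc (by positivity) ?_
      rw [div_le_one hNpos]
      exact_mod_cast hj'
    have hlen : ((j + 1 : ℕ) : ℝ) / N - j / N = (N : ℝ)⁻¹ := by push_cast; field_simp; ring
    have hle : (j : ℝ) / N ≤ (j + 1 : ℕ) / N := by
      have := inv_pos.2 hNpos; linarith
    have key := Convex.norm_image_sub_le_of_norm_hasDerivWithin_le
      (hs := convex_Icc ((j : ℝ) / N) ((j + 1 : ℕ) / N)) (f := fun s => φ s - s • φ' (j / N))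
      (f' := fun s => φ' s - φ' (j / N)) (C := ε / 2)
      (fun s hs => by
        have := (h s (hsub hs)).sub ((hasDerivAt_id s).smul_const (φ' (j / N)))
        simp only [one_smul] at this
        exact this.hasDerivWithinAt)
      (fun s hs => by
        rw [← dist_eq_norm]
        refine (hu s (hsub hs) _ (hsub (left_mem_Icc.2 hle)) ?_).le
        rw [Real.dist_eq, abs_of_nonneg (sub_nonneg.2 hs.1)]
        linarith [hs.2])
      (left_mem_Icc.2 hle) (right_mem_Icc.2 hle)
    rw [Real.norm_eq_abs, hlen, abs_of_pos (inv_pos.2 hNpos)] at key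
    rw [norm_sub_rev]
    refine le_trans (le_of_eq (congrArg _ ?_)) key
    rw [← hlen, sub_smul]
    abel
  have htel : ∑ j ∈ Finset.range N, (φ ((j + 1 : ℕ) / N) - φ (j / N)) = φ 1 - φ 0 := by
    rw [Finset.sum_range_sub (fun j : ℕ => φ (j / N))]
    simp [div_self hNpos.ne']
  rw [dist_eq_norm, ← htel, Finset.smul_sum, ← Finset.sum_sub_distrib]
  calc _ ≤ ∑ _j ∈ Finset.range N, (ε / 2) * (N : ℝ)⁻¹ :=
        (norm_sum_le _ _).trans (Finset.sum_le_sum hstep)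
    _ = ε / 2 := by
        rw [Finset.sum_const, Finset.card_range, nsmul_eq_mul]; field_simp
    _ < ε := half_lt_self hε

/-- The mean value inequality for a square-integrable process that is differentiable in quadratic
mean. -/
theorem ae_rational_increments {E S : Type*} [NormedAddCommGroup E] [NormedSpace ℝ E]
    [MeasurableSpace S] {P : Measure S} {G G' : E → Lp ℝ 2 P} {Ω : Set E} {x e : E} {t : ℝ}
    (hG : ∀ y ∈ Ω, HasLineDerivAt ℝ G (G' y) y e) (hG' : ContinuousOn G' Ω)
    (hseg : ∀ s ∈ Icc (0 : ℝ) 1, x + (s * t) • e ∈ Ω) :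
    ∀ᵐ ω ∂P, ∀ c ε : ℝ, (∀ s : ℚ, (s : ℝ) ∈ Icc (0 : ℝ) 1 →
        |G' (x + ((s : ℝ) * t) • e) ω - c| ≤ ε) →
      |G (x + t • e) ω - G x ω - t * c| ≤ |t| * ε := by
  -- The increment is an L² limit of Riemann sums, so a subsequence converges almost surely. The
  -- exceptional set is fixed before `c` and `ε`.
  have hlim := tendsto_riemann_sum (φ := fun s : ℝ => G (x + (s * t) • e))
    (φ' := fun s : ℝ => t • G' (x + (s * t) • e))
    (fun s hs => by
      have h1 := (hG _ (hseg s hs)).hasDerivAt_line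
      have h2 := h1.scomp s ((hasDerivAt_id s).mul_const t)
      simpa [Function.comp_def] using h2)
    ((hG'.comp (by fun_prop) fun s hs => hseg s hs).const_smul t)
  simp only [one_mul, zero_mul, zero_smul, add_zero] at hlim
  obtain ⟨ns, hns, hae⟩ := (tendstoInMeasure_of_tendsto_Lp hlim).exists_seq_tendsto_ae
  have hcoe : ∀ᵐ ω ∂P, ∀ N : ℕ,
      ((N : ℝ)⁻¹ • ∑ j ∈ Finset.range N, t • G' (x + ((j : ℝ) / N * t) • e) : Lp ℝ 2 P) ω =
        (N : ℝ)⁻¹ * ∑ j ∈ Finset.range N, t * G' (x + ((j : ℝ) / N * t) • e) ω := by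
    refine ae_all_iff.2 fun N => ?_
    have h1 : ∀ᵐ ω ∂P, ∀ j ∈ Finset.range N, (t • G' (x + ((j : ℝ) / N * t) • e) : Lp ℝ 2 P) ω =
        t * G' (x + ((j : ℝ) / N * t) • e) ω := by
      rw [Finset.eventually_all]
      intro j _
      filter_upwards [Lp.coeFn_smul t (G' (x + ((j : ℝ) / N * t) • e))] with ω h2
      rw [h2, Pi.smul_apply, smul_eq_mul]
    filter_upwards [h1, Lp.coeFn_smul (N : ℝ)⁻¹
      (∑ j ∈ Finset.range N, t • G' (x + ((j : ℝ) / N * t) • e)),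
      Lp.coeFn_finsetSum (Finset.range N) fun j => t • G' (x + ((j : ℝ) / N * t) • e)]
      with ω h2 h3 h4
    rw [h3, Pi.smul_apply, h4, Finset.sum_apply, smul_eq_mul, Finset.sum_congr rfl h2]
  filter_upwards [hae, hcoe, Lp.coeFn_sub (G (x + t • e)) (G x)] with ω h1 h2 h3 c ε hb
  rw [h3, Pi.sub_apply] at h1
  have h4 := ((h1.sub_const (t * c)).abs)
  refine le_of_tendsto h4 ?_
  filter_upwards [hns.tendsto_atTop.eventually_ge_atTop 1] with i hi
  have hNpos : (0 : ℝ) < ns i := by exact_mod_cast hi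
  rw [h2]
  have h5 : (ns i : ℝ)⁻¹ * ∑ j ∈ Finset.range (ns i), t * G' (x + ((j : ℝ) / ns i * t) • e) ω -
      t * c = (ns i : ℝ)⁻¹ * ∑ j ∈ Finset.range (ns i),
        t * (G' (x + ((j : ℝ) / ns i * t) • e) ω - c) := by
    simp only [mul_sub, Finset.sum_sub_distrib, Finset.sum_const, Finset.card_range,
      nsmul_eq_mul]
    field_simp
  rw [h5, abs_mul, abs_of_pos (inv_pos.2 hNpos)]
  calc _ ≤ (ns i : ℝ)⁻¹ * ∑ _j ∈ Finset.range (ns i), |t| * ε := by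
        gcongr
        refine (Finset.abs_sum_le_sum_abs _ _).trans (Finset.sum_le_sum fun j hj => ?_)
        rw [abs_mul]
        have hj' : (j : ℝ) ≤ ns i := by exact_mod_cast (Finset.mem_range.1 hj).le
        -- The nodes of the Riemann sums are rational, so a bound at rational parameters suffices.
        have := hb (j / ns i) (by
          push_cast
          exact ⟨by positivity, (div_le_one hNpos).2 hj'⟩)
        push_cast at this
        gcongr
    _ = |t| * ε := by
        rw [Finset.sum_const, Finset.card_range, nsmul_eq_mul]; field_simp

/-- A function on `T` that is uniformly continuous near a point of the closure of `T` has a limit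
there. -/
theorem exists_tendsto_of_uniformContinuousOn_inter {X : Type*} [MetricSpace X] {T B : Set X}
    {f : X → ℝ} {u : X} (hu : u ∈ closure T) (hB : B ∈ 𝓝 u) (hf : UniformContinuousOn f (T ∩ B)) :
    ∃ y, Tendsto f (𝓝[T] u) (𝓝 y) := by
  have : NeBot (𝓝[T] u) := mem_closure_iff_nhdsWithin_neBot.1 hu
  have hcau : Cauchy (map f (𝓝[T] u)) :=
    (cauchy_nhds.mono nhdsWithin_le_nhds).map_of_le hf
      (le_principal_iff.2 (inter_mem self_mem_nhdsWithin (nhdsWithin_le_nhds hB)))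
  exact cauchy_map_iff_exists_tendsto.1 hcau

end Paths

/-! ### Hölder continuity in quadratic mean -/

section PiecewiseHolder

variable {d : ℕ} {F : Type*} [NormedAddCommGroup F] {Ω : Set (EuclideanSpace ℝ (Fin d))}

/-- `G` is Hölder continuous, with fixed constants, on all convex subsets of `Ω` and on the members
of a finite cover of `Ω`. -/
def IsPiecewiseHolder (Ω : Set (EuclideanSpace ℝ (Fin d))) (G : EuclideanSpace ℝ (Fin d) → F) :
    Prop :=
  ∃ β > (0 : ℝ), ∃ L : ℝ, 0 ≤ L ∧
    (∃ 𝒜 : Set (Set (EuclideanSpace ℝ (Fin d))), 𝒜.Finite ∧ (∀ A ∈ 𝒜, A ⊆ Ω) ∧ Ω ⊆ ⋃₀ 𝒜 ∧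
      ∀ A ∈ 𝒜, ∀ x ∈ A, ∀ y ∈ A, ‖G x - G y‖ ≤ L * dist x y ^ β) ∧
    ∀ A ⊆ Ω, Convex ℝ A → ∀ x ∈ A, ∀ y ∈ A, ‖G x - G y‖ ≤ L * dist x y ^ β

theorem InteriorConeCondition.isPiecewiseHolder (hcone : InteriorConeCondition Ω)
    (hΩ : IsOpen Ω) (hbdd : Bornology.IsBounded Ω) [NormedSpace ℝ F]
    {G : EuclideanSpace ℝ (Fin d) → F} {G' : Fin d → EuclideanSpace ℝ (Fin d) → F} {B : Fin d → ℝ}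
    (hG : ∀ a, ∀ u ∈ Ω, HasLineDerivAt ℝ G (G' a u) u (EuclideanSpace.single a 1))
    (hG' : ∀ a, ∀ u ∈ Ω, ‖G' a u‖ ≤ B a) : IsPiecewiseHolder Ω G := by
  set B₀ : ℝ := ∑ a, |B a| with hB₀
  have hB₀0 : 0 ≤ B₀ := Finset.sum_nonneg fun a _ => abs_nonneg _
  have hB : ∀ a, ∀ u ∈ Ω, ‖G' a u‖ ≤ B₀ := fun a u hu =>
    (hG' a u hu).trans ((le_abs_self _).trans
      (Finset.single_le_sum (f := fun a => |B a|) (fun a _ => abs_nonneg _) (Finset.mem_univ a)))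
  have hseg : ∀ x z : EuclideanSpace ℝ (Fin d), (∀ s ∈ Icc (0 : ℝ) 1, x + s • z ∈ Ω) →
      ‖G (x + z) - G x‖ ≤ d * B₀ * ‖z‖ := fun x z hxz =>
    norm_sub_le_of_segment_subset hΩ hB₀0 hG hB hxz
  obtain ⟨𝒜, hfin, hsub, hcov, K, hK0, hK⟩ := hcone.exists_finite_cover hbdd (F := F)
  refine ⟨1, one_pos, d * B₀ * K + d * B₀, by positivity, ⟨𝒜, hfin, hsub, hcov, ?_⟩, ?_⟩
  · intro A hA x hx y hy
    rw [Real.rpow_one, dist_eq_norm]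
    refine (hK A hA G (d * B₀) (by positivity) hseg x hx y hy).trans ?_
    gcongr
    exact le_add_of_nonneg_right (by positivity)
  · intro A hA hconv x hx y hy
    rw [Real.rpow_one, dist_comm, dist_eq_norm, norm_sub_rev]
    have h1 := hseg x (y - x) fun s hs => hA (hconv.add_smul_sub_mem hx hy hs)
    rw [add_sub_cancel] at h1
    refine h1.trans ?_
    gcongr
    exact le_add_of_nonneg_left (by positivity)

/-- If `p` is not an integer, the Hölder bound on the kernel suffices, with `Ω` as the only piece.
If `p` is an integer, then `|l| ≤ p - 1`, so one more L² derivative exists and is bounded, and the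
cone condition turns this into Lipschitz bounds on pieces. -/
theorem MemCC.isPiecewiseHolder {H : Type*} [NormedAddCommGroup H] [InnerProductSpace ℝ H]
    [CompleteSpace H] {p : ℝ} {k : EuclideanSpace ℝ (Fin d) → EuclideanSpace ℝ (Fin d) → ℝ}
    {G : EuclideanSpace ℝ (Fin d) → H} (hk : MemCC Ω p k) (hΩ : IsOpen Ω)
    (hbdd : Bornology.IsBounded Ω) (hcone : InteriorConeCondition Ω)
    (hG : ∀ u ∈ Ω, ∀ v ∈ Ω, inner ℝ (G u) (G v) = k u v) (hp : 0 < p) {l : List (Fin d)}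
    (hl : (l.length : ℝ) < p) : IsPiecewiseHolder Ω (vecIterPartial G l) := by
  have hl' : l.length ≤ ⌊p⌋₊ := Nat.le_floor hl.le
  rcases (Nat.floor_le hp.le).lt_or_eq with h | h
  · obtain ⟨L, hL0, hL⟩ := hk.exists_norm_sub_vecIterPartial_le_rpow hΩ hG hl' (sub_pos.2 h)
    refine ⟨_, half_pos (sub_pos.2 h), L, hL0, ⟨{Ω}, finite_singleton _, ?_, ?_, ?_⟩, ?_⟩
    · simp
    · simp
    · rintro _ rfl
      exact hL
    · exact fun A hA _ x hx y hy => hL x (hA hx) y (hA hy)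
  · have hlt : l.length < ⌊p⌋₊ := by
      rw [← h] at hl
      exact_mod_cast hl
    have hB : ∀ a : Fin d, ∃ B : ℝ, 0 ≤ B ∧ ∀ u ∈ Ω, ‖vecIterPartial G (a :: l) u‖ ≤ B :=
      fun a => hk.exists_norm_vecIterPartial_le hΩ hG hlt
    choose B _ hB using hB
    exact hcone.isPiecewiseHolder hΩ hbdd
      (fun a u hu => hk.hasLineDerivAt_vecIterPartial hΩ hG hlt hu) hB

end PiecewiseHolder

/-! ### Continuity and boundedness of sample paths -/

section SamplePaths

variable {d : ℕ} {S : Type*} [MeasurableSpace S] {P : Measure S}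
  {Ω : Set (EuclideanSpace ℝ (Fin d))}

/-- All moments are available, so `q` can be taken with `β * q ≥ 2 * d + 2` however small `β` is.
The surplus power of the distance is absorbed by the bound `R'` on the diameter. -/
theorem ae_uniformContinuousOn_of_holder {V : Submodule ℝ (Lp ℝ 2 P)}
    (hV : ∀ f ∈ V, ∀ q : ℕ, ∫⁻ ω, ‖f ω‖ₑ ^ q ∂P ≤ stdGaussianMoment q * ‖f‖ₑ ^ q)
    {A : Set (EuclideanSpace ℝ (Fin d))} (hA : Bornology.IsBounded A)
    {G : EuclideanSpace ℝ (Fin d) → Lp ℝ 2 P} (hGV : ∀ x ∈ A, G x ∈ V) {β L : ℝ} (hβ : 0 < β)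
    (hL : 0 ≤ L) (hG : ∀ x ∈ A, ∀ y ∈ A, ‖G x - G y‖ ≤ L * dist x y ^ β)
    {T : Set (EuclideanSpace ℝ (Fin d))} (hT : T.Countable) (hTA : T ⊆ A) :
    ∀ᵐ ω ∂P, UniformContinuousOn (fun x => G x ω) T := by
  obtain ⟨R, hR⟩ := Metric.isBounded_iff.1 hA
  set R' : ℝ := max R 1 with hR'
  have hR'pos : 0 < R' := lt_max_of_lt_right one_pos
  obtain ⟨q, hq⟩ := exists_nat_gt (((2 * d + 2 : ℕ) : ℝ) / β)
  have hqpos : (0 : ℝ) < q := lt_of_le_of_lt (by positivity) hq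
  have hqβ : ((2 * d + 2 : ℕ) : ℝ) ≤ β * q := by
    rw [div_lt_iff₀ hβ] at hq
    linarith
  set D : ℝ := L ^ q * R' ^ (β * q - (2 * d + 2 : ℕ)) with hD
  have hD0 : 0 ≤ D := by positivity
  refine ae_uniformContinuousOn_of_moment hA (q := q)
    (C := stdGaussianMoment q * ENNReal.ofReal D)
    (fun x _ => (Lp.aestronglyMeasurable (G x)).aemeasurable) (by exact_mod_cast hqpos.ne')
    (ENNReal.mul_ne_top (stdGaussianMoment_ne_top q) ENNReal.ofReal_ne_top) ?_ hT hTA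
  intro x hx y hy
  have h1 : ‖G x - G y‖ ^ q ≤ D * dist x y ^ (2 * d + 2) := by
    calc ‖G x - G y‖ ^ q ≤ (L * dist x y ^ β) ^ q := by gcongr; exact hG x hx y hy
      _ = L ^ q * dist x y ^ (β * q) := by
          rw [mul_pow, ← Real.rpow_natCast (dist x y ^ β), ← Real.rpow_mul dist_nonneg]
      _ = L ^ q * (dist x y ^ (β * q - (2 * d + 2 : ℕ)) * dist x y ^ (2 * d + 2)) := by
          rw [← Real.rpow_natCast (dist x y) (2 * d + 2), ← Real.rpow_add_of_nonneg dist_nonneg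
            (sub_nonneg.2 hqβ) (by positivity), sub_add_cancel]
      _ ≤ L ^ q * (R' ^ (β * q - (2 * d + 2 : ℕ)) * dist x y ^ (2 * d + 2)) := by
          gcongr
          · exact (hR hx hy).trans (le_max_left _ _)
      _ = _ := by rw [hD]; ring
  have h2 : ‖G x - G y‖ₑ ^ q ≤ ENNReal.ofReal D * edist x y ^ (2 * d + 2) := by
    rw [← ofReal_norm, ← ENNReal.ofReal_pow (norm_nonneg _), edist_dist,
      ← ENNReal.ofReal_pow dist_nonneg, ← ENNReal.ofReal_mul hD0]
    exact ENNReal.ofReal_le_ofReal h1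
  have h3 : ∫⁻ ω, ‖G x ω - G y ω‖ₑ ^ q ∂P = ∫⁻ ω, ‖(G x - G y : Lp ℝ 2 P) ω‖ₑ ^ q ∂P := by
    refine lintegral_congr_ae ?_
    filter_upwards [Lp.coeFn_sub (G x) (G y)] with ω hω
    rw [hω, Pi.sub_apply]
  rw [h3, mul_assoc]
  exact (hV _ (V.sub_mem (hGV x hx) (hGV y hy)) q).trans (by gcongr)

theorem isBounded_image_of_uniformContinuousOn {X Y : Type*} [PseudoMetricSpace X]
    [PseudoMetricSpace Y] {A : Set X} (hA : TotallyBounded A) {f : X → Y}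
    (hf : UniformContinuousOn f A) : Bornology.IsBounded (f '' A) := by
  obtain ⟨δ, hδ, h⟩ := Metric.uniformContinuousOn_iff.1 hf 1 one_pos
  obtain ⟨N, hNA, hN, hcov⟩ := Metric.finite_approx_of_totallyBounded hA δ hδ
  refine ((Bornology.isBounded_biUnion hN).2 fun y _ =>
    Metric.isBounded_ball (x := f y) (r := 1)).subset ?_
  rintro _ ⟨x, hx, rfl⟩
  obtain ⟨y, hy, hxy⟩ := mem_iUnion₂.1 (hcov hx)
  exact mem_biUnion hy (h x hx y (hNA hy) hxy)

/-- The finite cover yields boundedness. Its members need not be neighbourhoods of their points, so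
limits come instead from balls inside `Ω`; centres in `T` and radii `1 / (n + 1)` leave countably
many null sets. -/
theorem ae_tendsto_and_bounded {V : Submodule ℝ (Lp ℝ 2 P)}
    (hV : ∀ f ∈ V, ∀ q : ℕ, ∫⁻ ω, ‖f ω‖ₑ ^ q ∂P ≤ stdGaussianMoment q * ‖f‖ₑ ^ q)
    (hΩ : IsOpen Ω) (hbdd : Bornology.IsBounded Ω) {G : EuclideanSpace ℝ (Fin d) → Lp ℝ 2 P}
    (hGV : ∀ x ∈ Ω, G x ∈ V) (hG : IsPiecewiseHolder Ω G)
    {T : Set (EuclideanSpace ℝ (Fin d))} (hT : T.Countable) (hTΩ : T ⊆ Ω) (hΩT : Ω ⊆ closure T) :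
    ∀ᵐ ω ∂P, (∀ u ∈ Ω, ∃ y, Tendsto (fun x => G x ω) (𝓝[T] u) (𝓝 y)) ∧
      ∃ M : ℝ, ∀ x ∈ T, |G x ω| ≤ M := by
  obtain ⟨β, hβ, L, hL, ⟨𝒜, hfin, hsub, hcov, h𝒜⟩, hconv⟩ := hG
  have hunif : ∀ A ⊆ Ω, (∀ x ∈ A, ∀ y ∈ A, ‖G x - G y‖ ≤ L * dist x y ^ β) →
      ∀ᵐ ω ∂P, UniformContinuousOn (fun x => G x ω) (T ∩ A) := fun A hA hGA =>
    ae_uniformContinuousOn_of_holder hV (hbdd.subset hA) (fun x hx => hGV x (hA hx)) hβ hL hGA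
      (hT.mono inter_subset_left) inter_subset_right
  have h1 : ∀ᵐ ω ∂P, ∀ A ∈ 𝒜, UniformContinuousOn (fun x => G x ω) (T ∩ A) :=
    (ae_ball_iff hfin.countable).2 fun A hA => hunif A (hsub A hA) (h𝒜 A hA)
  have h2 : ∀ᵐ ω ∂P, ∀ x ∈ T, ∀ n : ℕ, Metric.ball x (1 / (n + 1)) ⊆ Ω →
      UniformContinuousOn (fun x => G x ω) (T ∩ Metric.ball x (1 / (n + 1))) :=
    (ae_ball_iff hT).2 fun x _ => ae_all_iff.2 fun n => by
      by_cases hb : Metric.ball x (1 / (n + 1 : ℝ)) ⊆ Ω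
      · filter_upwards [hunif _ hb (hconv _ hb (convex_ball _ _))] with ω hω _ using hω
      · exact Eventually.of_forall fun ω hω => absurd hω hb
  filter_upwards [h1, h2] with ω hω1 hω2
  refine ⟨fun u hu => ?_, ?_⟩
  · obtain ⟨ρ, hρ, hball⟩ := Metric.isOpen_iff.1 hΩ u hu
    obtain ⟨n, hn⟩ := exists_nat_one_div_lt (half_pos hρ)
    obtain ⟨x, hxT, hx⟩ := Metric.mem_closure_iff.1 (hΩT hu) (1 / (n + 1 : ℝ)) (by positivity)
    have hb : Metric.ball x (1 / (n + 1 : ℝ)) ⊆ Ω := by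
      refine Subset.trans (fun y hy => ?_) hball
      rw [Metric.mem_ball] at hy ⊢
      have := dist_triangle y x u
      rw [dist_comm x u] at this
      linarith
    exact exists_tendsto_of_uniformContinuousOn_inter (hΩT hu)
      (Metric.isOpen_ball.mem_nhds hx) (hω2 x hxT n hb)
  · have hbd : ∀ A ∈ 𝒜, Bornology.IsBounded ((fun x => G x ω) '' (T ∩ A)) := fun A hA =>
      isBounded_image_of_uniformContinuousOn
        ((hbdd.subset hTΩ).isCompact_closure.totallyBounded.subset
          (inter_subset_left.trans subset_closure)) (hω1 A hA)
    have hTb : Bornology.IsBounded ((fun x => G x ω) '' T) := by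
      refine ((Bornology.isBounded_biUnion hfin).2 hbd).subset ?_
      rintro _ ⟨x, hx, rfl⟩
      obtain ⟨A, hA, hxA⟩ := hcov (hTΩ hx)
      exact mem_biUnion hA ⟨x, ⟨hx, hxA⟩, rfl⟩
    obtain ⟨M, hM⟩ := hTb.exists_norm_le
    exact ⟨M, fun x hx => hM _ (mem_image_of_mem _ hx)⟩

end SamplePaths

/-! ### Recognising a function of class `C^m` -/

section ContinuousDerivatives

variable {d : ℕ} {Ω : Set (EuclideanSpace ℝ (Fin d))}

theorem isHolderOn_zero {f : EuclideanSpace ℝ (Fin d) → ℝ} (hf : ContinuousOn f Ω) {M : ℝ}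
    (hM : ∀ x ∈ Ω, |f x| ≤ M) : IsHolderOn Ω 0 f := by
  refine ⟨hf, ⟨M, hM⟩, (2 * M).toNNReal, fun x hx y hy => ?_⟩
  rw [NNReal.coe_zero, ENNReal.rpow_zero, mul_one, edist_dist]
  refine ENNReal.ofReal_le_ofReal ?_
  rw [Real.dist_eq]
  have := abs_sub (f x) (f y)
  linarith [hM x hx, hM y hy]

theorem hasIterPartial_and_eqOn (hΩ : IsOpen Ω) {g : EuclideanSpace ℝ (Fin d) → ℝ}
    {f : List (Fin d) → EuclideanSpace ℝ (Fin d) → ℝ} {m : ℕ} (hg : EqOn g (f []) Ω)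
    (hf : ∀ (a : Fin d) (l : List (Fin d)), (a :: l).length ≤ m → ∀ u ∈ Ω,
      HasLineDerivAt ℝ (f l) (f (a :: l) u) u (EuclideanSpace.single a 1))
    {l : List (Fin d)} (hl : l.length ≤ m) :
    HasIterPartial Ω l g ∧ EqOn (iterPartial l g) (f l) Ω := by
  induction l with
  | nil => exact ⟨trivial, hg⟩
  | cons a l ih =>
    obtain ⟨h1, h2⟩ := ih ((Nat.le_succ _).trans hl)
    have h3 : ∀ u ∈ Ω, HasLineDerivAt ℝ (iterPartial l g) (f (a :: l) u) u
        (EuclideanSpace.single a 1) := fun u hu => by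
      refine (hf a l hl u hu).congr_of_eventuallyEq ?_
      filter_upwards [hΩ.mem_nhds hu] with v hv using h2 hv
    exact ⟨⟨h1, fun u hu => (h3 u hu).lineDifferentiableAt⟩, fun u hu => (h3 u hu).lineDeriv⟩

theorem memC_of_eqOn (hΩ : IsOpen Ω) {g : EuclideanSpace ℝ (Fin d) → ℝ}
    {f : List (Fin d) → EuclideanSpace ℝ (Fin d) → ℝ} {m : ℕ} (hg : EqOn g (f []) Ω)
    (hf : ∀ (a : Fin d) (l : List (Fin d)), (a :: l).length ≤ m → ∀ u ∈ Ω,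
      HasLineDerivAt ℝ (f l) (f (a :: l) u) u (EuclideanSpace.single a 1))
    (hc : ∀ l : List (Fin d), l.length ≤ m → ContinuousOn (f l) Ω)
    (hb : ∀ l : List (Fin d), l.length ≤ m → ∃ M : ℝ, ∀ x ∈ Ω, |f l x| ≤ M) : MemC Ω m g := by
  intro l hl
  rw [Nat.floor_natCast] at hl
  obtain ⟨h1, h2⟩ := hasIterPartial_and_eqOn hΩ hg hf hl
  obtain ⟨M, hM⟩ := hb l hl
  rw [Nat.floor_natCast, sub_self, Real.toNNReal_zero]
  exact ⟨h1, isHolderOn_zero ((hc l hl).congr h2) fun x hx => by rw [h2 hx]; exact hM x hx⟩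

end ContinuousDerivatives

/-! ### Construction of the modification -/

theorem lemma4p5 {d : ℕ} (Ω : Set (EuclideanSpace ℝ (Fin d)))
    (hΩ_open : IsOpen Ω) (hΩ_bdd : Bornology.IsBounded Ω) (hΩ_cone : InteriorConeCondition Ω)
    (p : ℝ) (hp : 0 < p)
    (k : EuclideanSpace ℝ (Fin d) → EuclideanSpace ℝ (Fin d) → ℝ) (hk : MemCC Ω p k)
    {S : Type*} [MeasurableSpace S] (P : Measure S) [IsProbabilityMeasure P]
    (g : EuclideanSpace ℝ (Fin d) → S → ℝ) (hg : IsCenteredGP P Ω k g) :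
    ∃ g' : EuclideanSpace ℝ (Fin d) → S → ℝ,
      IsModification P Ω g g' ∧ ∀ᵐ ω ∂P, MemC Ω (⌈p - 1⌉ : ℤ) (fun u => g' u ω) := by
  classical
  obtain ⟨m, hm⟩ : ∃ m : ℕ, ⌈p - 1⌉ = (m : ℤ) :=
    Int.eq_ofNat_of_zero_le (Int.lt_add_one_iff.1 (by
      have := Int.le_ceil (p - 1)
      have h : (-1 : ℝ) < ⌈p - 1⌉ := by linarith
      have h' : (-1 : ℤ) < ⌈p - 1⌉ := by exact_mod_cast h
      omega))
  have hmp : (m : ℝ) < p := by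
    have := Int.ceil_lt_add_one (p - 1)
    rw [hm] at this
    push_cast at this
    linarith
  have hmf : m ≤ ⌊p⌋₊ := Nat.le_floor hmp.le
  rw [hm, Int.cast_natCast]
  have hmem : ∀ u ∈ Ω, MemLp (g u) 2 P := fun u hu =>
    (hg.isGaussianProcess.hasGaussianLaw_eval ⟨u, hu⟩).memLp_two
  -- Square integrability of `g u` is known only on `Ω`; the value `0` elsewhere plays no role.
  set G₀ : EuclideanSpace ℝ (Fin d) → Lp ℝ 2 P := fun u =>
    if h : u ∈ Ω then (hmem u h).toLp (g u) else 0 with hG₀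
  have hcoe : ∀ u ∈ Ω, G₀ u =ᵐ[P] g u := fun u hu => by
    simp only [hG₀, dif_pos hu]
    exact (hmem u hu).coeFn_toLp
  have hinner : ∀ u ∈ Ω, ∀ v ∈ Ω, inner ℝ (G₀ u) (G₀ v) = k u v := fun u hu v hv => by
    rw [← hg.covariance_eq u hu v hv, covariance, hg.mean_eq_zero u hu, hg.mean_eq_zero v hv,
      L2.inner_def]
    refine integral_congr_ae ?_
    filter_upwards [hcoe u hu, hcoe v hv] with ω h1 h2
    rw [h1, h2]
    simp [mul_comm]
  set V : Submodule ℝ (Lp ℝ 2 P) :=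
    (Submodule.span ℝ (range fun u : Ω => G₀ u)).topologicalClosure with hVdef
  have hVmom : ∀ f ∈ V, ∀ q : ℕ, ∫⁻ ω, ‖f ω‖ₑ ^ q ∂P ≤ stdGaussianMoment q * ‖f‖ₑ ^ q :=
    fun f hf q => IsGaussianProcess.lintegral_enorm_pow_le hg.isGaussianProcess
      (fun u => hg.mean_eq_zero u u.2) (fun u => hcoe u u.2) hf q
  have hGV : ∀ l, ∀ u ∈ Ω, vecIterPartial G₀ l u ∈ V := fun l =>
    vecIterPartial_mem hΩ_open (Submodule.isClosed_topologicalClosure _)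
      (fun u hu => Submodule.le_topologicalClosure _ (Submodule.subset_span
        (mem_range_self (f := fun u : Ω => G₀ u) ⟨u, hu⟩))) l
  set T : Set (EuclideanSpace ℝ (Fin d)) := Ω ∩ rationalPoints d with hTdef
  have hTc : T.Countable := (rationalPoints_countable d).mono inter_subset_right
  have hTΩ : T ⊆ Ω := inter_subset_left
  have hΩT : Ω ⊆ closure T := (dense_rationalPoints d).open_subset_closure_inter hΩ_open
  have hpaths : ∀ᵐ ω ∂P, ∀ l : List (Fin d), l.length ≤ m →
      (∀ u ∈ Ω, ∃ y, Tendsto (fun x => vecIterPartial G₀ l x ω) (𝓝[T] u) (𝓝 y)) ∧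
        ∃ M : ℝ, ∀ x ∈ T, |vecIterPartial G₀ l x ω| ≤ M := by
    refine ae_all_iff.2 fun l => ?_
    by_cases hl : l.length ≤ m
    · have hlp : (l.length : ℝ) < p := lt_of_le_of_lt (by exact_mod_cast hl) hmp
      filter_upwards [ae_tendsto_and_bounded hVmom hΩ_open hΩ_bdd (hGV l)
        (hk.isPiecewiseHolder hΩ_open hΩ_bdd hΩ_cone hinner hp hlp) hTc hTΩ hΩT] with ω h _ using h
    · exact Eventually.of_forall fun ω h => absurd h hl
  have hincr : ∀ᵐ ω ∂P, ∀ (a : Fin d) (l : List (Fin d)), ∀ x ∈ rationalPoints d, ∀ t : ℚ,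
      (a :: l).length ≤ m →
      (∀ s ∈ Icc (0 : ℝ) 1, x + (s * t) • EuclideanSpace.single a (1 : ℝ) ∈ Ω) →
      ∀ c ε : ℝ, (∀ s : ℚ, (s : ℝ) ∈ Icc (0 : ℝ) 1 →
        |vecIterPartial G₀ (a :: l) (x + ((s : ℝ) * t) • EuclideanSpace.single a (1 : ℝ)) ω - c|
          ≤ ε) →
      |vecIterPartial G₀ l (x + (t : ℝ) • EuclideanSpace.single a (1 : ℝ)) ω -
        vecIterPartial G₀ l x ω - t * c| ≤ |(t : ℝ)| * ε := by
    refine ae_all_iff.2 fun a => ae_all_iff.2 fun l =>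
      (ae_ball_iff (rationalPoints_countable d)).2 fun x _ => ae_all_iff.2 fun t => ?_
    by_cases hl : (a :: l).length ≤ m
    · by_cases hs : ∀ s ∈ Icc (0 : ℝ) 1, x + (s * t) • EuclideanSpace.single a (1 : ℝ) ∈ Ω
      · filter_upwards [ae_rational_increments
          (fun y hy => hk.hasLineDerivAt_vecIterPartial hΩ_open hinner (hl.trans hmf) hy)
          (hk.continuousOn_vecIterPartial hΩ_open hinner (hl.trans hmf)) hs] with ω h _ _ using h
      · exact Eventually.of_forall fun ω _ h => absurd h hs
    · exact Eventually.of_forall fun ω h => absurd h hl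
  -- The approximating sequences do not depend on `ω`. The `limsup` along them is thus measurable in
  -- `ω`, and almost surely it equals the continuous extension from `T`.
  have hseq : ∀ u, ∃ s : ℕ → EuclideanSpace ℝ (Fin d),
      u ∈ Ω → (∀ n, s n ∈ T) ∧ Tendsto s atTop (𝓝 u) := fun u => by
    by_cases hu : u ∈ Ω
    · obtain ⟨s, hs⟩ := mem_closure_iff_seq_limit.1 (hΩT hu)
      exact ⟨s, fun _ => hs⟩
    · exact ⟨fun _ => u, fun h => absurd h hu⟩
  choose s hs using hseq
  have hsT : ∀ u ∈ Ω, Tendsto (s u) atTop (𝓝[T] u) := fun u hu =>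
    tendsto_nhdsWithin_iff.2 ⟨(hs u hu).2, Eventually.of_forall (hs u hu).1⟩
  have hlimsup : ∀ᵐ ω ∂P, ∀ u ∈ Ω, Tendsto (fun j => G₀ (s u j) ω) atTop
      (𝓝 (extendFrom T (fun x => G₀ x ω) u)) := by
    filter_upwards [hpaths] with ω hω u hu
    exact (tendsto_extendFrom ((hω [] (Nat.zero_le _)).1 u hu)).comp (hsT u hu)
  refine ⟨fun u ω => limsup (fun j => G₀ (s u j) ω) atTop, fun u hu => ⟨?_, ?_⟩, ?_⟩
  · exact Measurable.limsup fun j => (Lp.stronglyMeasurable (G₀ (s u j))).measurable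
  -- Continuity in L² identifies the pathwise limit with `g u`, almost surely for each fixed `u`.
  · have hL2 : Tendsto (fun j => G₀ (s u j)) atTop (𝓝 (G₀ u)) :=
      (((hk.continuousOn_vecIterPartial hΩ_open hinner (l := []) (Nat.zero_le _)).continuousAt
        (hΩ_open.mem_nhds hu)).tendsto).comp (hs u hu).2
    obtain ⟨ns, hns, hae⟩ := (tendstoInMeasure_of_tendsto_Lp hL2).exists_seq_tendsto_ae
    filter_upwards [hae, hlimsup, hcoe u hu] with ω h1 h2 h3
    rw [(h2 u hu).limsup_eq, ← h3]
    exact tendsto_nhds_unique h1 ((h2 u hu).comp hns.tendsto_atTop)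
  · filter_upwards [hpaths, hincr, hlimsup] with ω h1 h2 h3
    set f : List (Fin d) → EuclideanSpace ℝ (Fin d) → ℝ := fun l =>
      extendFrom T fun x => vecIterPartial G₀ l x ω with hf
    have hfc : ∀ l : List (Fin d), l.length ≤ m → ContinuousOn (f l) Ω := fun l hl =>
      continuousOn_extendFrom hΩT (h1 l hl).1
    have hfT : ∀ l : List (Fin d), l.length ≤ m → ∀ x ∈ T, f l x = vecIterPartial G₀ l x ω :=
      fun l hl x hx => by
        obtain ⟨y, hy⟩ := (h1 l hl).1 x (hTΩ hx)
        have hxy : vecIterPartial G₀ l x ω = y :=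
          tendsto_nhds_unique (tendsto_pure_nhds (fun x => vecIterPartial G₀ l x ω) x)
            (hy.mono_left (pure_le_nhdsWithin hx))
        rw [hxy]
        exact extendFrom_eq (subset_closure hx) hy
    refine memC_of_eqOn hΩ_open (f := f) (fun u hu => (h3 u hu).limsup_eq) ?_ hfc ?_
    · intro a l hl u hu
      have hl' : l.length ≤ m := (Nat.le_succ _).trans hl
      refine hasLineDerivAt_of_rational_increments hΩ_open (hfc l hl') (hfc _ hl) ?_ hu
      intro x hx t hseg c ε hb
      -- Every point entering the mean value inequality lies in `T`, where the extensions agree with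
      -- the chosen L² representatives.
      have hrat : ∀ r : ℚ, (r : ℝ) ∈ Icc (0 : ℝ) 1 →
          x + ((r : ℝ) * t) • EuclideanSpace.single a (1 : ℝ) ∈ T := fun r hr =>
        ⟨hseg r hr, by exact_mod_cast add_smul_single_mem_rationalPoints hx (r * t) a⟩
      have hx0 : x ∈ T := by simpa using hrat 0 (by simp)
      have hx1 : x + (t : ℝ) • EuclideanSpace.single a (1 : ℝ) ∈ T := by
        simpa using hrat 1 (by simp)
      rw [hfT l hl' _ hx0, hfT l hl' _ hx1]
      refine h2 a l x hx t hl hseg c ε fun r hr => ?_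
      rw [← hfT _ hl _ (hrat r hr)]
      exact hb r hr
    · intro l hl
      obtain ⟨M, hM⟩ := (h1 l hl).2
      refine ⟨M, fun u hu => ?_⟩
      have hlim := ((tendsto_extendFrom ((h1 l hl).1 u hu)).comp (hsT u hu)).abs
      exact le_of_tendsto hlim (Eventually.of_forall fun j => hM _ ((hs u hu).1 j))
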